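/- Let $q>2$ be a prime power, let $n\in\{-1,0,1\}$ with $q\equiv n\pmod 3$, and let $g=\gcd(3,q-1)$. Let $V$ be a 3-dimensional vector space over $\mathbb{F}_{q^3}$, so that $V$ gives $\mathrm{PG}(2,q^3)$ and, regarded as a 9-dimensional space over $\mathbb{F}_q$, gives $\mathrm{PG}(8,q)$. A point $\bar P$ of $\mathrm{PG}(2,q^3)$ is a 3-dimensional $\mathbb{F}_q$-subspace of $V$, that is, a plane $[\![P]\!]$ of $\mathrm{PG}(8,q)$, called an $\mathbb{S}$-plane; a line of $\mathrm{PG}(2,q^3)$ is likewise a 5-space of $\mathrm{PG}(8,q)$, called an $\mathbb{H}$-5-space. The $\mathbb{S}$-planes form a regular 2-spread of $\mathrm{PG}(8,q)$. Let $\phi$ be a collineation of $\mathrm{PG}(2,q^3)$ of order 3 which fixes pointwise an $\mathbb{F}_q$-plane (the set of points with coordinates in $\mathbb{F}_q$ with respect to some basis of $V$). Let $\sigma\in\mathrm{PGL}(9,q)$ be a projectivity of $\mathrm{PG}(8,q)$ that induces $\phi$, that is, $[\![P]\!]^\sigma=[\![\phi(P)]\!]$ for every point $\bar P$ of $\mathrm{PG}(2,q^3)$.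 A point of $\mathrm{PG}(2,q^3)$ has Type I if it is fixed by $\phi$, and Type II if its $\phi$-orbit consists of three distinct collinear points; a line of $\mathrm{PG}(2,q^3)$ has Type I if it is fixed by $\phi$. The corresponding $\mathbb{S}$-planes and $\mathbb{H}$-5-spaces are given the same type. A I-point (II-point) is a point of $\mathrm{PG}(8,q)$ lying in an $\mathbb{S}$-plane of Type I (Type II). A fixed point is a point $A$ of $\mathrm{PG}(8,q)$ with $A^\sigma=A$; a $\mathrm{I}_{:}$-point is a I-point $A$ such that $A,A^\sigma,A^{\sigma^2}$ are distinct and collinear; a $\mathrm{II}_{:}$-point is a II-point $A$ such that $A,A^\sigma,A^{\sigma^2}$ are collinear. A ptwise-fixed line (plane) is a line (plane) of $\mathrm{PG}(8,q)$ all of whose points are fixed. A fixed-I-line is a line of $\mathrm{PG}(8,q)$ fixed by $\sigma$ which contains exactly $n+1$ fixed points and $q-n$ $\mathrm{I}_{:}$-points and is contained in an $\mathbb{S}$-plane of Type I. A fixed-II-line is a line fixed by $\sigma$ which contains exactly $n+1$ fixed points and $q-n$ $\mathrm{II}_{:}$-points, meets exactly $n+1$ $\mathbb{S}$-planes of Type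 I and $q-n$ $\mathbb{S}$-planes of Type II, and is contained in a unique $\mathbb{H}$-5-space, which has Type I. Let $\Pi$ be a 5-space of $\mathrm{PG}(8,q)$ that is fixed hyperplane-wise by $\sigma$, that is, every hyperplane (7-space) containing $\Pi$ is fixed by $\sigma$. Then $\Pi$ contains exactly * $(n+1)(q^2+q+1)$ fixed points, $(q-n)(q^2+q+1)$ $\mathrm{I}_{:}$-points and $(q^3-q)(q^2+q+1)$ $\mathrm{II}_{:}$-points; * $(n+1)(q^2+q+1)$ ptwise-fixed lines, $q^2+q+1$ fixed-I-lines and $(q^3-q)(q^2+q+1)/(q-n)$ fixed-II-lines; * $n+1$ ptwise-fixed planes; and there are exactly $g-(n+1)$ further ptwise-fixed planes in $\mathrm{PG}(8,q)$, each of which is disjoint from $\Pi$. -/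

import Mathlib

open scoped LinearAlgebra.Projectivization

namespace BoseRep

section General

variable {F W : Type*} [Field F] [AddCommGroup W] [Module F W]

/-- `U` is a projective subspace of (projective) dimension `d` of `PG(W)`:
a vector subspace of rank `d + 1`. -/
def IsSubspaceOfDim (d : ℕ) (U : Submodule F W) : Prop :=
  Module.finrank F U = d + 1

/-- The point `P` lies on the projective subspace `U`. -/
def On (P : ℙ F W) (U : Submodule F W) : Prop :=
  P.submodule ≤ U

/-- Three points lie on a common line. -/
def Collinear (P Q R : ℙ F W) : Prop :=
  ∃ l : Submodule F W, IsSubspaceOfDim 1 l ∧ On P l ∧ On Q l ∧ On R l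

/-- A collineation: a permutation of the points that preserves collinearity in both directions. -/
def IsCollineation (φ : Equiv.Perm (ℙ F W)) : Prop :=
  ∀ P Q R, Collinear P Q R ↔ Collinear (φ P) (φ Q) (φ R)

/-- The action on points of the projectivity with linear representative `σ`. -/
def act (σ : W ≃ₗ[F] W) (P : ℙ F W) : ℙ F W :=
  Projectivization.map (σ : W →ₗ[F] W) σ.injective P

/-- The subspace `U` is fixed (as a set) by the projectivity represented by `σ`. -/
def IsFixedSubspace (σ : W ≃ₗ[F] W) (U : Submodule F W) : Prop :=
  U.map (σ : W →ₗ[F] W) = U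

/-- Every point of `U` is fixed by the projectivity represented by `σ`. -/
def IsPtwiseFixed (σ : W ≃ₗ[F] W) (U : Submodule F W) : Prop :=
  ∀ A : ℙ F W, On A U → act σ A = A

end General

section FieldReduction

variable {K L V : Type*} [Field K] [Field L] [Algebra K L] [AddCommGroup V]
  [Module K V] [Module L V] [IsScalarTower K L V]

variable (K) in
/-- A `K`-subplane of `PG(V)`, `V` of rank 3 over `L`: the points having coordinates in `K`
with respect to some `L`-basis of `V`. -/
def IsSubplane (B : Set (ℙ L V)) : Prop :=
  ∃ b : Module.Basis (Fin 3) L V,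
    B = {P | ∃ a : Fin 3 → K, ∃ h : (∑ i, a i • b i) ≠ 0, P = Projectivization.mk L (∑ i, a i • b i) h}

variable (K) in
/-- The spread element of `PG(8, q)` corresponding to a point of `PG(2, q³)`. -/
def sPlane (P : ℙ L V) : Submodule K V :=
  P.submodule.restrictScalars K

variable (K) in
/-- The 5-space of `PG(8, q)` corresponding to a line `m` of `PG(2, q³)`. -/
def hSpace (m : Submodule L V) : Submodule K V :=
  m.restrictScalars K

/-- The projectivity of `PG(8, q)` represented by `σ` induces `φ` on the spread elements. -/
def Induces (σ : V ≃ₗ[K] V) (φ : Equiv.Perm (ℙ L V)) : Prop :=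
  ∀ P : ℙ L V, (sPlane K P).map (σ : V →ₗ[K] V) = sPlane K (φ P)

/-- Type I: the orbit under `φ` is one point. -/
def IsTypeI (φ : Equiv.Perm (ℙ L V)) (P : ℙ L V) : Prop :=
  φ P = P

/-- Type II: the orbit under `φ` (of order 3) consists of three collinear points. -/
def IsTypeII (φ : Equiv.Perm (ℙ L V)) (P : ℙ L V) : Prop :=
  P ≠ φ P ∧ φ P ≠ φ (φ P) ∧ P ≠ φ (φ P) ∧ Collinear P (φ P) (φ (φ P))

/-- A line of `PG(2, q³)` whose orbit under `φ` is one line. -/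
def IsTypeILine (φ : Equiv.Perm (ℙ L V)) (m : Submodule L V) : Prop :=
  IsSubspaceOfDim 1 m ∧ ∀ P : ℙ L V, On P m ↔ On (φ P) m

/-- A point of `PG(8, q)` in a spread element of Type I. -/
def IsIPoint (φ : Equiv.Perm (ℙ L V)) (A : ℙ K V) : Prop :=
  ∃ P : ℙ L V, IsTypeI φ P ∧ On A (sPlane K P)

/-- A point of `PG(8, q)` in a spread element of Type II. -/
def IsIIPoint (φ : Equiv.Perm (ℙ L V)) (A : ℙ K V) : Prop :=
  ∃ P : ℙ L V, IsTypeII φ P ∧ On A (sPlane K P)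

/-- A `I:`-point: a I-point with three distinct collinear points in its orbit. -/
def IsIColonPoint (φ : Equiv.Perm (ℙ L V)) (σ : V ≃ₗ[K] V) (A : ℙ K V) : Prop :=
  IsIPoint φ A ∧ A ≠ act σ A ∧ act σ A ≠ act σ (act σ A) ∧ A ≠ act σ (act σ A) ∧
    Collinear A (act σ A) (act σ (act σ A))

/-- A `II:`-point: a II-point with collinear orbit. -/
def IsIIColonPoint (φ : Equiv.Perm (ℙ L V)) (σ : V ≃ₗ[K] V) (A : ℙ K V) : Prop :=
  IsIIPoint φ A ∧ Collinear A (act σ A) (act σ (act σ A))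

/-- A line of `PG(8, q)` that is fixed pointwise. -/
def IsPtwiseFixedLine (σ : V ≃ₗ[K] V) (l : Submodule K V) : Prop :=
  IsSubspaceOfDim 1 l ∧ IsPtwiseFixed σ l

/-- A plane of `PG(8, q)` that is fixed pointwise. -/
def IsPtwiseFixedPlane (σ : V ≃ₗ[K] V) (U : Submodule K V) : Prop :=
  IsSubspaceOfDim 2 U ∧ IsPtwiseFixed σ U

/-- A fixed-I-line: a fixed line with exactly `n + 1` fixed points and `q - n` `I:`-points,
contained in a spread element of Type I. -/
def IsFixedILine (φ : Equiv.Perm (ℙ L V)) (σ : V ≃ₗ[K] V) (n : ℤ) (l : Submodule K V) : Prop :=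
  IsSubspaceOfDim 1 l ∧ IsFixedSubspace σ l ∧
  ({A : ℙ K V | On A l ∧ act σ A = A}.ncard : ℤ) = n + 1 ∧
  ({A : ℙ K V | On A l ∧ IsIColonPoint φ σ A}.ncard : ℤ) = Nat.card K - n ∧
  ∃ P : ℙ L V, IsTypeI φ P ∧ l ≤ sPlane K P

/-- A fixed-II-line: a fixed line with exactly `n + 1` fixed points and `q - n` `II:`-points,
meeting `n + 1` spread elements of Type I and `q - n` spread elements of Type II, and contained
in a unique 5-space corresponding to a line of `PG(2, q³)`, which has Type I. -/
def IsFixedIILine (φ : Equiv.Perm (ℙ L V)) (σ : V ≃ₗ[K] V) (n : ℤ) (l : Submodule K V) : Prop :=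
  IsSubspaceOfDim 1 l ∧ IsFixedSubspace σ l ∧
  ({A : ℙ K V | On A l ∧ act σ A = A}.ncard : ℤ) = n + 1 ∧
  ({A : ℙ K V | On A l ∧ IsIIColonPoint φ σ A}.ncard : ℤ) = Nat.card K - n ∧
  ({P : ℙ L V | IsTypeI φ P ∧ ¬ Disjoint l (sPlane K P)}.ncard : ℤ) = n + 1 ∧
  ({P : ℙ L V | IsTypeII φ P ∧ ¬ Disjoint l (sPlane K P)}.ncard : ℤ) = Nat.card K - n ∧
  ∃ m : Submodule L V, IsTypeILine φ m ∧ l ≤ hSpace K m ∧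
    ∀ m' : Submodule L V, IsSubspaceOfDim 1 m' → l ≤ hSpace K m' → m' = m

/-- A 5-space of `PG(8, q)` fixed hyperplane-wise: every hyperplane (7-space) through it is
fixed. -/
def IsHwiseFixed5Space (σ : V ≃ₗ[K] V) (U : Submodule K V) : Prop :=
  IsSubspaceOfDim 5 U ∧
    ∀ H : Submodule K V, IsSubspaceOfDim 7 H → U ≤ H → IsFixedSubspace σ H

end FieldReduction

end BoseRep

/-!
Up to a scalar in `K`, `σ` is the map `τ` that applies a nontrivial automorphism of `L / K` to the
coordinates with respect to a suitable `L`-basis of `V`. Indeed `σ` is semilinear and multiplies all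
vectors of a basis defining the subplane by a common factor in `L`. As every hyperplane through `U`
is fixed, `σ` acts on `V / U` as a scalar `c ∈ K`, so it also has an eigenvector with eigenvalue
`c`, and scaling the basis by a nonzero coordinate of this vector turns `σ` into `c τ`. Then
`τ³ = 1` and `U` is the kernel of `1 + τ + τ²`.

The fixed points are the eigenvectors of `τ`. By Hilbert's theorem 90, each cube root of unity `μ`
in `K` has an eigenspace of dimension 3, which lies in `U` when `μ² + μ + 1 = 0` and meets `U`
trivially otherwise; the number of `μ` of the first kind is `n + 1`. A spread plane of Type I meets
`U` in a line, which yields the I-points and the fixed-I-lines, and all other points of `U` are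
II-points. Such a point `A` satisfies `A + A^τ + A^(τ²) = 0` on representatives, so the line joining
`A` and `A^τ` is fixed and is the only fixed line through `A`; counting incident pairs of II-points
and fixed-II-lines gives the number of the latter.
-/

namespace BoseRep

section ProjectiveSpace

variable {F W : Type*} [Field F] [AddCommGroup W] [Module F W]

theorem on_mk {v : W} {hv : v ≠ 0} {U : Submodule F W} :
    On (Projectivization.mk F v hv) U ↔ v ∈ U := by
  simp [On, Projectivization.submodule_mk]

theorem act_mk (σ : W ≃ₗ[F] W) {v : W} (hv : v ≠ 0) :
    act σ (Projectivization.mk F v hv) =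
      Projectivization.mk F (σ v) (σ.map_ne_zero_iff.2 hv) := rfl

theorem act_mk_eq_self_iff (σ : W ≃ₗ[F] W) {v : W} (hv : v ≠ 0) :
    act σ (Projectivization.mk F v hv) = Projectivization.mk F v hv ↔ ∃ μ : F, σ v = μ • v := by
  rw [act_mk, Projectivization.mk_eq_mk_iff']
  exact exists_congr fun _ => eq_comm

theorem not_disjoint_iff_exists_on {U U' : Submodule F W} :
    ¬ Disjoint U U' ↔ ∃ A : ℙ F W, On A U ∧ On A U' := by
  rw [Submodule.disjoint_def]
  push Not
  constructor
  · rintro ⟨v, hU, hU', hv⟩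
    exact ⟨Projectivization.mk F v hv, on_mk.2 hU, on_mk.2 hU'⟩
  · rintro ⟨A, hU, hU'⟩
    induction A using Projectivization.ind with
    | h v hv => exact ⟨v, on_mk.1 hU, on_mk.1 hU', hv⟩

theorem ncard_setOf_on [Finite F] (U : Submodule F W) :
    {A : ℙ F W | On A U}.ncard = ∑ i ∈ Finset.range (Module.finrank F U), Nat.card F ^ i := by
  rw [← Projectivization.card_of_finrank F U rfl, ← Set.ncard_range_of_injective
    (Projectivization.map_injective U.subtype U.injective_subtype)]
  congr 1
  ext A
  constructor
  · induction A using Projectivization.ind with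
    | h v hv => exact fun hA => ⟨.mk F ⟨v, on_mk.1 hA⟩ (by simpa using hv), rfl⟩
  · rintro ⟨B, rfl⟩
    induction B using Projectivization.ind with
    | h v hv => exact on_mk.2 v.2

theorem ncard_setOf_finrank_add_one_eq [Finite F] [FiniteDimensional F W] :
    {H : Submodule F W | Module.finrank F H + 1 = Module.finrank F W}.ncard =
      ∑ i ∈ Finset.range (Module.finrank F W), Nat.card F ^ i := by
  rw [← Projectivization.card_of_finrank F (Module.Dual F W) Subspace.dual_finrank_eq,
    ← Nat.card_coe_set_eq]
  refine Nat.card_congr (Equiv.trans ?_ (Projectivization.equivSubmodule F _).symm)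
  refine ((Subspace.orderIsoFiniteDimensional (K := F) (V := W)).toEquiv.trans
    OrderDual.ofDual).subtypeEquiv fun H => ?_
  have := Subspace.finrank_add_finrank_dualAnnihilator_eq H
  change Module.finrank F H + 1 = Module.finrank F W ↔ Module.finrank F H.dualAnnihilator = 1
  omega

theorem ncard_setOf_le_finrank_add_one_eq [Finite F] (U : Submodule F W)
    [FiniteDimensional F U] :
    {H : Submodule F W | H ≤ U ∧ Module.finrank F H + 1 = Module.finrank F U}.ncard =
      ∑ i ∈ Finset.range (Module.finrank F U), Nat.card F ^ i := by
  rw [← ncard_setOf_finrank_add_one_eq,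
    ← Set.ncard_image_of_injective _ (Submodule.map_injective_of_injective U.injective_subtype)]
  congr 1
  ext H
  constructor
  · rintro ⟨hH, hdim⟩
    refine ⟨H.comap U.subtype, ?_, by rw [Submodule.map_comap_subtype, inf_eq_right.2 hH]⟩
    rw [Set.mem_ofPred_eq, ← hdim, (Submodule.comapSubtypeEquivOfLe hH).finrank_eq]
  · rintro ⟨H, hdim, rfl⟩
    exact ⟨Submodule.map_subtype_le _ _, by rwa [Submodule.finrank_map_subtype_eq]⟩

theorem exists_eq_smul_of_forall_mem (T : W →ₗ[F] W) (U : Submodule F W)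
    (h : ∀ v ∈ U, ∃ μ : F, T v = μ • v) : ∃ μ : F, ∀ v ∈ U, T v = μ • v := by
  have maps : ∀ v ∈ U, T v ∈ U := fun v hv => by
    obtain ⟨μ, hμ⟩ := h v hv
    exact hμ ▸ U.smul_mem μ hv
  obtain ⟨μ, hμ⟩ := LinearMap.exists_eq_smul_id_of_forall_notLinearIndependent
    (f := T.restrict maps) fun v hli => by
      obtain ⟨μ, hμ⟩ := h v v.2
      have := (LinearIndependent.pair_iff.1 hli μ (-1) (by ext; simp [hμ])).2
      simp at this
  exact ⟨μ, fun v hv => by simpa using congrArg Subtype.val (LinearMap.congr_fun hμ ⟨v, hv⟩)⟩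

theorem isPtwiseFixed_iff_exists_le_eigenspace {σ : W ≃ₗ[F] W} {U : Submodule F W} :
    IsPtwiseFixed σ U ↔ ∃ μ : F, U ≤ Module.End.eigenspace σ.toLinearMap μ := by
  constructor
  · intro h
    obtain ⟨μ, hμ⟩ := exists_eq_smul_of_forall_mem σ.toLinearMap U fun v hv => by
      by_cases h0 : v = 0
      · exact ⟨0, by simp [h0]⟩
      · exact (act_mk_eq_self_iff σ h0).1 (h _ (on_mk.2 hv))
    exact ⟨μ, fun v hv => Module.End.mem_eigenspace_iff.2 (hμ v hv)⟩
  · rintro ⟨μ, hμ⟩ A hA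
    induction A using Projectivization.ind with
    | h v hv =>
      exact (act_mk_eq_self_iff σ hv).2 ⟨μ, Module.End.mem_eigenspace_iff.1 (hμ (on_mk.1 hA))⟩

theorem finrank_span_pair_eq_two {v w : W} (hv : v ≠ 0) (h : ∀ a : F, a • v ≠ w) :
    Module.finrank F (Submodule.span F {v, w}) = 2 := by
  have := finrank_span_eq_card ((LinearIndependent.pair_iff' hv).2 h)
  rwa [Matrix.range_cons_cons_empty, Fintype.card_fin] at this

theorem span_pair_eq_of_finrank_eq_two {l : Submodule F W} (hl : Module.finrank F l = 2)
    {v w : W} (hv : v ≠ 0) (h : ∀ a : F, a • v ≠ w) (hvl : v ∈ l) (hwl : w ∈ l) :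
    Submodule.span F {v, w} = l := by
  have : FiniteDimensional F l := Module.finite_of_finrank_pos (by omega)
  refine Submodule.eq_of_le_of_finrank_eq ?_ (by rw [finrank_span_pair_eq_two hv h, hl])
  exact Submodule.span_le.2 (Set.pair_subset hvl hwl)

theorem mk_ne_mk_iff {v w : W} (hv : v ≠ 0) (hw : w ≠ 0) :
    Projectivization.mk F w hw ≠ Projectivization.mk F v hv ↔ ∀ a : F, a • v ≠ w := by
  rw [Ne, Projectivization.mk_eq_mk_iff', not_exists]

theorem le_of_on_of_on {l m : Submodule F W} (hl : Module.finrank F l = 2)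
    {A B : ℙ F W} (hAB : A ≠ B) (hAl : On A l) (hBl : On B l) (hAm : On A m) (hBm : On B m) :
    l ≤ m := by
  induction A using Projectivization.ind with
  | h v hv =>
  induction B using Projectivization.ind with
  | h w hw =>
  rw [on_mk] at hAl hBl hAm hBm
  rw [← span_pair_eq_of_finrank_eq_two hl hv ((mk_ne_mk_iff hv hw).1 hAB.symm) hAl hBl]
  exact Submodule.span_le.2 (Set.pair_subset hAm hBm)

theorem collinear_mk_of_add_eq_zero {u v w : W} (hu : u ≠ 0) (hv : v ≠ 0) (hw : w ≠ 0)
    (h : u + v + w = 0) (hne : Projectivization.mk F v hv ≠ Projectivization.mk F u hu) :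
    Collinear (Projectivization.mk F u hu) (Projectivization.mk F v hv)
      (Projectivization.mk F w hw) := by
  refine ⟨Submodule.span F {u, v}, finrank_span_pair_eq_two hu ((mk_ne_mk_iff hu hv).1 hne),
    on_mk.2 (Submodule.mem_span_of_mem (by simp)), on_mk.2 (Submodule.mem_span_of_mem (by simp)),
    on_mk.2 (Submodule.mem_span_pair.2 ⟨-1, -1, ?_⟩)⟩
  rw [eq_neg_of_add_eq_zero_right h]
  module

end ProjectiveSpace

theorem ncard_biUnion_eq_mul {ι α : Type*} {t : Set ι} (ht : t.Finite) {s : ι → Set α} {m : ℕ}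
    (hs : ∀ i ∈ t, (s i).Finite) (hm : ∀ i ∈ t, (s i).ncard = m) (h : t.PairwiseDisjoint s) :
    (⋃ i ∈ t, s i).ncard = t.ncard * m := by
  rw [ht.ncard_biUnion hs h, finsum_mem_congr rfl hm, finsum_mem_eq_finite_toFinset_sum _ ht,
    Finset.sum_const, smul_eq_mul, Set.ncard_eq_toFinset_card t ht]

theorem geom_sum_three {R : Type*} [Semiring R] (x : R) :
    ∑ i ∈ Finset.range 3, x ^ i = x ^ 2 + x + 1 := by
  rw [geom_sum_succ', geom_sum_two, add_assoc]

section PrimeDegree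

variable {K L : Type*} [Field K] [Field L] [Algebra K L] {f : L ≃ₐ[K] L}

theorem fixedField_zpowers_eq_bot (hL : (Module.finrank K L).Prime) (hf : f ≠ 1) :
    IntermediateField.fixedField (Subgroup.zpowers f) = ⊥ := by
  have := IntermediateField.isSimpleOrder_of_finrank_prime K L hL
  refine (eq_bot_or_eq_top _).resolve_right fun htop => hf (AlgEquiv.ext fun x => ?_)
  have hx : x ∈ IntermediateField.fixedField (Subgroup.zpowers f) :=
    htop ▸ IntermediateField.mem_top
  exact hx ⟨f, Subgroup.mem_zpowers f⟩

theorem orderOf_eq_finrank (hL : (Module.finrank K L).Prime) (hf : f ≠ 1) :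
    orderOf f = Module.finrank K L := by
  have : FiniteDimensional K L := Module.finite_of_finrank_pos hL.pos
  rw [← Nat.card_zpowers, ← IntermediateField.finrank_fixedField_eq_card,
    fixedField_zpowers_eq_bot hL hf, IntermediateField.finrank_bot']

theorem exists_algebraMap_eq_of_apply_eq (hL : (Module.finrank K L).Prime) (hf : f ≠ 1) {x : L}
    (hx : f x = x) : ∃ a : K, algebraMap K L a = x := by
  rw [← Set.mem_range, ← IntermediateField.mem_bot, ← fixedField_zpowers_eq_bot hL hf]
  have hle : Subgroup.zpowers f ≤ MulAction.stabilizer (L ≃ₐ[K] L) x := by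
    rwa [Subgroup.zpowers_le]
  exact fun g => hle g.2

theorem linearIndependent_pow_algEquiv (f : L ≃ₐ[K] L) :
    LinearIndependent L fun (i : Fin (orderOf f)) (x : L) => (f ^ (i : ℕ)) x := by
  refine (linearIndependent_monoidHom L L).comp
    (fun i : Fin (orderOf f) => ((f ^ (i : ℕ) : L ≃ₐ[K] L) : L →* L)) fun i j hij => ?_
  exact Fin.ext (pow_injOn_Iio_orderOf i.2 j.2 (AlgEquiv.ext fun x => DFunLike.congr_fun hij x))

end PrimeDegree

section CubicExtension

variable {K L V : Type*} [Field K] [Field L] [Algebra K L] [AddCommGroup V] [Module K V]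

/-- The kernel of the trace `1 + T + T²` of an operator `T`, meant for `T³ = 1`. For `τ` as in
`IsCubicFrobenius` it is the 5-space fixed hyperplane-wise. -/
def traceKer (T : Module.End K V) : Submodule K V :=
  LinearMap.ker (1 + T + T ^ 2)

theorem mem_traceKer {T : Module.End K V} {v : V} :
    v ∈ traceKer T ↔ v + T v + T (T v) = 0 := Iff.rfl

variable {f : L ≃ₐ[K] L}

theorem algEquiv_apply_apply_apply (hL : Module.finrank K L = 3) (f : L ≃ₐ[K] L) (x : L) :
    f (f (f x)) = x := by
  by_cases hf : f = 1
  · simp [hf]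
  · have h3 : f ^ 3 = 1 := by
      rw [← hL, ← orderOf_eq_finrank (hL ▸ Nat.prime_three) hf, pow_orderOf_eq_one]
    exact DFunLike.congr_fun h3 x

theorem exists_add_mul_apply_ne_zero (hL : Module.finrank K L = 3) (hf : f ≠ 1) (a b : L) :
    ∃ y, y + a * f y + b * f (f y) ≠ 0 := by
  by_contra! h
  have hli := linearIndependent_pow_algEquiv f
  rw [orderOf_eq_finrank (hL ▸ Nat.prime_three) hf, hL, Fintype.linearIndependent_iff] at hli
  refine one_ne_zero (hli ![1, a, b] (funext fun y => ?_) 0)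
  simpa [Fin.sum_univ_three, pow_two] using h y

/-- Hilbert's theorem 90, in degree 3. -/
theorem exists_apply_mul_eq_self (hL : Module.finrank K L = 3) (hf : f ≠ 1) {c : L}
    (hc : c * f c * f (f c) = 1) : ∃ x, x ≠ 0 ∧ f x * c = x := by
  obtain ⟨y, hy⟩ := exists_add_mul_apply_ne_zero hL hf c (c * f c)
  refine ⟨_, hy, ?_⟩
  simp only [map_add, map_mul, algEquiv_apply_apply_apply hL]
  linear_combination y * hc

theorem finrank_eigenspace_algEquiv (hL : Module.finrank K L = 3) (hf : f ≠ 1) {μ : K}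
    (hμ : μ ^ 3 = 1) : Module.finrank K (Module.End.eigenspace f.toLinearMap μ) = 1 := by
  have hμ' : algebraMap K L μ ^ 3 = 1 := by rw [← map_pow, hμ, map_one]
  obtain ⟨x, hx, hfx⟩ := exists_apply_mul_eq_self (c := algebraMap K L μ ^ 2) hL hf (by
    simp only [map_pow, AlgEquiv.commutes]
    linear_combination (algebraMap K L μ ^ 3 + 1) * hμ')
  have eigenvector_iff {y : L} :
      y ∈ Module.End.eigenspace f.toLinearMap μ ↔ f y = algebraMap K L μ * y := by
    rw [Module.End.mem_eigenspace_iff, Algebra.smul_def, AlgEquiv.toLinearMap_apply]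
  have hx' : f x = algebraMap K L μ * x := by linear_combination algebraMap K L μ * hfx - f x * hμ'
  refine finrank_eq_one_iff'.2 ⟨⟨x, eigenvector_iff.2 hx'⟩, Subtype.coe_ne_coe.1 hx, ?_⟩
  rintro ⟨y, hy⟩
  obtain ⟨a, ha⟩ := exists_algebraMap_eq_of_apply_eq (hL ▸ Nat.prime_three) hf (x := y / x) (by
    rw [map_div₀, hx', eigenvector_iff.1 hy, mul_div_mul_left _ _ fun h => by simp [h] at hμ'])
  refine ⟨a, Subtype.ext (?_ : a • x = y)⟩
  rw [Algebra.smul_def, ha, div_mul_cancel₀ _ hx]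

theorem finrank_traceKer_algEquiv (hL : Module.finrank K L = 3) (hf : f ≠ 1) :
    Module.finrank K (traceKer f.toLinearMap) = 2 := by
  have : FiniteDimensional K L := Module.finite_of_finrank_pos (by omega)
  set T : Module.End K L := 1 + f.toLinearMap + f.toLinearMap ^ 2 with hT
  have apply_T (x : L) : T x = x + f x + f (f x) := rfl
  have range_le : LinearMap.range T ≤ Module.End.eigenspace f.toLinearMap 1 := by
    rintro _ ⟨x, rfl⟩
    rw [Module.End.mem_eigenspace_iff, one_smul, AlgEquiv.toLinearMap_apply, apply_T, map_add,
      map_add, algEquiv_apply_apply_apply hL]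
    ring
  have range_ne_bot : LinearMap.range T ≠ ⊥ := fun h => by
    obtain ⟨y, hy⟩ := exists_add_mul_apply_ne_zero hL hf 1 1
    rw [one_mul, one_mul, ← apply_T, LinearMap.range_eq_bot.1 h] at hy
    exact hy rfl
  have range_pos := Submodule.one_le_finrank_iff.2 range_ne_bot
  have range_le_one := Submodule.finrank_mono range_le
  have rank_nullity := hL ▸ LinearMap.finrank_range_add_finrank_ker T
  rw [finrank_eigenspace_algEquiv hL hf (one_pow 3)] at range_le_one
  rw [traceKer, ← hT]
  omega

end CubicExtension

section CubeRoots

variable {K : Type*} [Field K]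

variable (K) in
/-- The roots of `X² + X + 1`, that is, the eigenvalues of `T` that occur in `traceKer T` when
`T³ = 1`. In characteristic 3 the only one is `1`. -/
def omegaRoots : Set K := {μ | μ ^ 2 + μ + 1 = 0}

theorem mem_omegaRoots {μ : K} : μ ∈ omegaRoots K ↔ μ ^ 2 + μ + 1 = 0 := Iff.rfl

theorem pow_three_eq_one_of_mem_omegaRoots {μ : K} (h : μ ∈ omegaRoots K) : μ ^ 3 = 1 := by
  linear_combination (μ - 1) * mem_omegaRoots.1 h

theorem one_mem_omegaRoots_iff : (1 : K) ∈ omegaRoots K ↔ (3 : K) = 0 := by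
  rw [mem_omegaRoots]
  norm_num

theorem omegaRoots_eq_singleton (h : (3 : K) = 0) : omegaRoots K = {1} := by
  refine Set.eq_singleton_iff_unique_mem.2 ⟨one_mem_omegaRoots_iff.2 h, fun μ hμ => ?_⟩
  have : (μ - 1) ^ 2 = 0 := by linear_combination mem_omegaRoots.1 hμ - μ * h
  exact sub_eq_zero.1 (pow_eq_zero_iff two_ne_zero |>.1 this)

theorem omegaRoots_eq_sdiff (h : (3 : K) ≠ 0) : omegaRoots K = {μ : K | μ ^ 3 = 1} \ {1} := by
  ext μ
  constructor
  · intro hμ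
    refine ⟨pow_three_eq_one_of_mem_omegaRoots hμ, ?_⟩
    rintro rfl
    exact h (one_mem_omegaRoots_iff.1 hμ)
  · rintro ⟨hμ, hne⟩
    have : (μ - 1) * (μ ^ 2 + μ + 1) = 0 := by linear_combination Set.mem_ofPred.1 hμ
    exact (mul_eq_zero.1 this).resolve_left (sub_ne_zero.2 hne)

variable [Finite K]

theorem ofNat_three_eq_zero_iff : (3 : K) = 0 ↔ 3 ∣ Nat.card K := by
  have := Fintype.ofFinite K
  have : Fact (Nat.Prime 3) := ⟨Nat.prime_three⟩
  rw [Nat.card_eq_fintype_card, ← prime_dvd_char_iff_dvd_card,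
    Nat.prime_dvd_prime_iff_eq Nat.prime_three (CharP.char_is_prime K _), ← Nat.cast_ofNat,
    ringChar.spec, Nat.prime_dvd_prime_iff_eq (CharP.char_is_prime K _) Nat.prime_three, eq_comm]

theorem ncard_pow_eq_one {d : ℕ} (hd : d ≠ 0) :
    {μ : K | μ ^ d = 1}.ncard = (Nat.card K - 1).gcd d := by
  rw [← Nat.card_units, ← IsCyclic.card_powMonoidHom_ker Kˣ d, ← SetLike.coe_sort_coe,
    Nat.card_coe_set_eq, ← Set.ncard_image_of_injective _ Units.val_injective]
  congr 1
  ext μ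
  constructor
  · intro hμ
    exact ⟨Units.ofPowEqOne μ d hμ hd, Units.ext hμ, rfl⟩
  · rintro ⟨u, hu, rfl⟩
    exact congrArg Units.val hu

theorem ncard_omegaRoots {n : ℤ} (hn : n = -1 ∨ n = 0 ∨ n = 1)
    (hq : (Nat.card K : ℤ) ≡ n [ZMOD 3]) : ((omegaRoots K).ncard : ℤ) = n + 1 := by
  have hpos : 0 < Nat.card K := Nat.card_pos
  rw [Int.ModEq] at hq
  by_cases h : (3 : K) = 0
  · have := ofNat_three_eq_zero_iff.1 h
    rw [omegaRoots_eq_singleton h, Set.ncard_singleton]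
    omega
  · have h' := mt ofNat_three_eq_zero_iff.2 h
    rw [omegaRoots_eq_sdiff h,
      Set.ncard_sdiff_singleton_of_mem (s := {μ : K | μ ^ 3 = 1}) (one_pow 3),
      ncard_pow_eq_one three_ne_zero, Nat.gcd_comm]
    rcases (Nat.dvd_prime Nat.prime_three).1 (Nat.gcd_dvd_left 3 (Nat.card K - 1)) with hg | hg
    · have : ¬ 3 ∣ Nat.card K - 1 := fun h3 => by simp [Nat.gcd_eq_left h3] at hg
      omega
    · have : 3 ∣ Nat.card K - 1 := Nat.gcd_eq_left_iff_dvd.1 hg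
      omega

end CubeRoots

section Eigenvectors

variable {K V : Type*} [Field K] [AddCommGroup V] [Module K V] {T : Module.End K V}

theorem mem_traceKer_iff_of_mem_eigenspace {μ : K} {v : V} (hv : v ∈ T.eigenspace μ)
    (h0 : v ≠ 0) : v ∈ traceKer T ↔ μ ∈ omegaRoots K := by
  rw [Module.End.mem_eigenspace_iff] at hv
  have : v + T v + T (T v) = (μ ^ 2 + μ + 1) • v := by
    rw [hv, map_smul, hv]
    module
  rw [mem_traceKer, mem_omegaRoots, this, smul_eq_zero_iff_left h0]

theorem eigenspace_le_traceKer {μ : K} (hμ : μ ∈ omegaRoots K) :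
    T.eigenspace μ ≤ traceKer T := fun v hv => by
  by_cases h0 : v = 0
  · exact h0 ▸ zero_mem _
  · exact (mem_traceKer_iff_of_mem_eigenspace hv h0).2 hμ

theorem disjoint_eigenspace_traceKer {μ : K} (hμ : μ ∉ omegaRoots K) :
    Disjoint (T.eigenspace μ) (traceKer T) := by
  refine Submodule.disjoint_def.2 fun v hv hv' => ?_
  by_contra h0
  exact hμ ((mem_traceKer_iff_of_mem_eigenspace hv h0).1 hv')

theorem apply_mem_traceKer {v : V} (hv : v ∈ traceKer T) : T v ∈ traceKer T := by
  rw [mem_traceKer, ← map_add, ← map_add, mem_traceKer.1 hv, map_zero]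

/-- `X² + X + 1` splits as `(X - μ) (X + (1 + μ))`. -/
theorem apply_add_smul_mem_eigenspace {μ : K} (hμ : μ ∈ omegaRoots K) {v : V}
    (hv : v ∈ traceKer T) : T v + (1 + μ) • v ∈ T.eigenspace μ := by
  rw [Module.End.mem_eigenspace_iff, map_add, map_smul]
  linear_combination (norm := module) mem_traceKer.1 hv - mem_omegaRoots.1 hμ • v

theorem eigenvalue_unique_of_ne_bot {μ ν : K} {U : Submodule K V} (hU : U ≠ ⊥)
    (hμ : U ≤ T.eigenspace μ) (hν : U ≤ T.eigenspace ν) : μ = ν := by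
  by_contra h
  exact hU (disjoint_self.1 ((T.disjoint_genEigenspace h 1 1).mono hμ hν))

end Eigenvectors

section RestrictedKernel

variable {K L V ι : Type*} [Field K] [Field L] [Algebra K L] [AddCommGroup V] [Module K V]
  [Module L V] [IsScalarTower K L V] [FiniteDimensional K L] [Finite ι]

theorem finrank_span_inf_ker {b : ι → V} (hb : LinearIndependent L b) {A : Module.End K L}
    {B : Module.End K V} (hAB : ∀ x i, B (x • b i) = A x • b i) :
    Module.finrank K
      ((Submodule.span L (Set.range b)).restrictScalars K ⊓ LinearMap.ker B : Submodule K V) =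
      Nat.card ι * Module.finrank K (LinearMap.ker A) := by
  have := Fintype.ofFinite ι
  let Φ : (ι → L) →ₗ[K] V := (Fintype.linearCombination L b).restrictScalars K
  have Φ_apply (x : ι → L) : Φ x = ∑ i, x i • b i := Fintype.linearCombination_apply L b x
  have Φ_inj : Function.Injective Φ := linearIndependent_iff_injective_fintypeLinearCombination.1 hb
  have map_Φ (x : ι → L) : B (Φ x) = Φ (fun i => A (x i)) := by
    simp only [Φ_apply, map_sum, hAB]
  let j : (ι → LinearMap.ker A) →ₗ[K] (ι → L) := (LinearMap.ker A).subtype.compLeft ι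
  have j_inj : Function.Injective j := fun x y h => funext fun i => Subtype.ext (congrFun h i)
  have range_eq : LinearMap.range (Φ ∘ₗ j) =
      (Submodule.span L (Set.range b)).restrictScalars K ⊓ LinearMap.ker B := by
    ext v
    constructor
    · rintro ⟨x, rfl⟩
      refine ⟨(Fintype.range_linearCombination L b).le ⟨_, rfl⟩, ?_⟩
      have : B (Φ (j x)) = 0 := by
        rw [map_Φ, ← map_zero Φ]
        exact congrArg Φ (funext fun i => (x i).2)
      exact this
    · rintro ⟨hv, hBv⟩
      obtain ⟨x, rfl⟩ := (Fintype.range_linearCombination L b).ge hv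
      have hAx : (fun i => A (x i)) = 0 := Φ_inj (by rw [← map_Φ, map_zero]; exact hBv)
      exact ⟨fun i => ⟨x i, congrFun hAx i⟩, rfl⟩
  rw [← range_eq, LinearMap.finrank_range_of_inj (f := Φ ∘ₗ j) (Φ_inj.comp j_inj),
    Module.finrank_pi_fintype, Finset.sum_const, Finset.card_univ, Nat.card_eq_fintype_card,
    smul_eq_mul]

end RestrictedKernel

section SpreadPoint

variable {K L V : Type*} [Field K] [Field L] [Algebra K L] [AddCommGroup V]
  [Module K V] [Module L V] [IsScalarTower K L V] {σ : V ≃ₗ[K] V} {φ : Equiv.Perm (ℙ L V)}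

variable (L) in
/-- The point of `PG(V)` over `L` whose spread element contains a given point of `PG(V)` over
`K`. -/
noncomputable def spreadPoint (A : ℙ K V) : ℙ L V :=
  Projectivization.mk L A.rep A.rep_nonzero

theorem spreadPoint_mk {v : V} (hv : v ≠ 0) :
    spreadPoint L (Projectivization.mk K v hv) = Projectivization.mk L v hv := by
  obtain ⟨a, ha⟩ := Projectivization.exists_smul_eq_mk_rep K v hv
  refine (Projectivization.mk_eq_mk_iff' L _ _ _ _).2 ⟨algebraMap K L a, ?_⟩
  rw [algebraMap_smul, ← ha, Units.smul_def]

theorem sPlane_mk_eq {v : V} (hv : v ≠ 0) :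
    sPlane K (Projectivization.mk L v hv) =
      (Submodule.span L (Set.range fun _ : Unit => v)).restrictScalars K := by
  rw [sPlane, Projectivization.submodule_mk, Set.range_const]

theorem mem_sPlane_mk {v w : V} (hv : v ≠ 0) :
    w ∈ sPlane K (Projectivization.mk L v hv) ↔ ∃ x : L, x • v = w := by
  rw [sPlane, Submodule.restrictScalars_mem, Projectivization.submodule_mk,
    Submodule.mem_span_singleton]

theorem on_sPlane_iff {A : ℙ K V} {P : ℙ L V} : On A (sPlane K P) ↔ spreadPoint L A = P := by
  induction A using Projectivization.ind with
  | h v hv =>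
  induction P using Projectivization.ind with
  | h w hw =>
  rw [on_mk, spreadPoint_mk, Projectivization.mk_eq_mk_iff', mem_sPlane_mk]

theorem not_disjoint_sPlane_iff {l : Submodule K V} {P : ℙ L V} :
    ¬ Disjoint l (sPlane K P) ↔ ∃ A : ℙ K V, On A l ∧ spreadPoint L A = P := by
  simp only [not_disjoint_iff_exists_on, on_sPlane_iff]

theorem Induces.semiconj (hσ : Induces σ φ) : Function.Semiconj (spreadPoint L) (act σ) φ := by
  intro A
  induction A using Projectivization.ind with
  | h v hv =>
  rw [act_mk, ← on_sPlane_iff, ← hσ, on_mk]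
  exact Submodule.mem_map_of_mem (on_mk.1 (on_sPlane_iff.2 rfl))

theorem Induces.apply_mk (hσ : Induces σ φ) {v : V} (hv : v ≠ 0) :
    φ (Projectivization.mk L v hv) =
      Projectivization.mk L (σ v) (σ.map_ne_zero_iff.2 hv) := by
  rw [← spreadPoint_mk (K := K), ← hσ.semiconj, act_mk, spreadPoint_mk]

end SpreadPoint

section InducedCollineation

variable {K L V : Type*} [Field K] [Field L] [Algebra K L] [AddCommGroup V]
  [Module K V] [Module L V] [IsScalarTower K L V] {τ : V ≃ₗ[K] V} {φ : Equiv.Perm (ℙ L V)}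
  {A : ℙ K V}

theorem isIPoint_iff : IsIPoint φ A ↔ IsTypeI φ (spreadPoint L A) := by
  simp only [IsIPoint, on_sPlane_iff, exists_eq_right']

theorem isIIPoint_iff : IsIIPoint φ A ↔ IsTypeII φ (spreadPoint L A) := by
  simp only [IsIIPoint, on_sPlane_iff, exists_eq_right']

theorem isIPoint_of_act_eq (hφ : Function.Semiconj (spreadPoint L) (act τ) φ)
    (hA : act τ A = A) : IsIPoint φ A := by
  rw [isIPoint_iff, IsTypeI, ← hφ, hA]

theorem act_act_act_eq_self (hA : On A (traceKer τ.toLinearMap)) : act τ (act τ (act τ A)) = A := by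
  induction A using Projectivization.ind with
  | h v hv =>
  have hv0 := mem_traceKer.1 (on_mk.1 hA)
  have hv1 := mem_traceKer.1 (apply_mem_traceKer (on_mk.1 hA))
  have : τ (τ (τ v)) = v := by
    linear_combination (norm := module) hv1 - hv0
  simp only [act_mk, this]

theorem collinear_act_act (hA : On A (traceKer τ.toLinearMap)) (hne : act τ A ≠ A) :
    Collinear A (act τ A) (act τ (act τ A)) := by
  induction A using Projectivization.ind with
  | h v hv => exact collinear_mk_of_add_eq_zero _ _ _ (mem_traceKer.1 (on_mk.1 hA)) hne

theorem isIColonPoint_iff (hA : On A (traceKer τ.toLinearMap)) :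
    IsIColonPoint φ τ A ↔ IsIPoint φ A ∧ act τ A ≠ A := by
  have act_injective : Function.Injective (act τ) := Projectivization.map_injective _ τ.injective
  refine ⟨fun ⟨hI, hne, _⟩ => ⟨hI, hne.symm⟩, fun ⟨hI, hne⟩ => ?_⟩
  refine ⟨hI, hne.symm, fun h => hne (act_injective h).symm, fun h => hne ?_,
    collinear_act_act hA hne⟩
  conv_lhs => rw [h, act_act_act_eq_self hA]

theorem isIIPoint_iff_not_isIPoint (hφ : Function.Semiconj (spreadPoint L) (act τ) φ)
    (hA : On A (traceKer τ.toLinearMap)) : IsIIPoint φ A ↔ ¬ IsIPoint φ A := by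
  rw [isIPoint_iff, isIIPoint_iff]
  refine ⟨fun hII hI => hII.1 hI.symm, fun hI => ?_⟩
  refine ⟨Ne.symm hI, fun h => hI (φ.injective h).symm, fun h => hI ?_, ?_⟩
  · rw [IsTypeI]
    conv_lhs => rw [h, ← hφ, ← hφ, ← hφ, act_act_act_eq_self hA]
  · rw [IsTypeI] at hI
    rw [← hφ] at hI ⊢
    rw [← hφ]
    induction A using Projectivization.ind with
    | h v hv =>
    simp only [act_mk, spreadPoint_mk] at hI ⊢
    exact collinear_mk_of_add_eq_zero _ _ _ (mem_traceKer.1 (on_mk.1 hA)) hI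

theorem isIIColonPoint_iff (hφ : Function.Semiconj (spreadPoint L) (act τ) φ)
    (hA : On A (traceKer τ.toLinearMap)) : IsIIColonPoint φ τ A ↔ ¬ IsIPoint φ A := by
  rw [IsIIColonPoint, isIIPoint_iff_not_isIPoint hφ hA]
  exact and_iff_left_of_imp fun hI => collinear_act_act hA (mt (isIPoint_of_act_eq hφ) hI)

end InducedCollineation

section FixedSubspaces

variable {K V : Type*} [Field K] [AddCommGroup V] [Module K V] {τ : V ≃ₗ[K] V}
  {l U : Submodule K V}

theorem isFixedSubspace_of_forall_apply_mem [FiniteDimensional K U] (h : ∀ v ∈ U, τ v ∈ U) :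
    IsFixedSubspace τ U :=
  Submodule.eq_of_le_of_finrank_eq (Submodule.map_le_iff_le_comap.2 h)
    (LinearEquiv.finrank_map_eq τ U)

theorem IsFixedSubspace.apply_mem_iff (h : IsFixedSubspace τ U) {v : V} : τ v ∈ U ↔ v ∈ U := by
  conv_lhs => rw [← h]
  exact ⟨fun ⟨w, hw, hwv⟩ => τ.injective hwv ▸ hw, Submodule.mem_map_of_mem⟩

theorem IsFixedSubspace.on_act (h : IsFixedSubspace τ U) {A : ℙ K V} (hA : On A U) :
    On (act τ A) U := by
  induction A using Projectivization.ind with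
  | h v hv => exact on_mk.2 (h.apply_mem_iff.2 (on_mk.1 hA))

theorem act_mk_eq_self_iff_exists_mem_eigenspace (hU : U ≤ traceKer τ.toLinearMap) {v : V}
    (hv : v ≠ 0) (hvU : v ∈ U) : act τ (Projectivization.mk K v hv) = Projectivization.mk K v hv ↔
      ∃ μ ∈ omegaRoots K, v ∈ Module.End.eigenspace τ.toLinearMap μ := by
  rw [act_mk_eq_self_iff]
  constructor
  · rintro ⟨μ, hμ⟩
    have hvμ := Module.End.mem_eigenspace_iff.2 hμ
    exact ⟨μ, (mem_traceKer_iff_of_mem_eigenspace hvμ hv).1 (hU hvU), hvμ⟩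
  · rintro ⟨μ, -, hvμ⟩
    exact ⟨μ, Module.End.mem_eigenspace_iff.1 hvμ⟩

theorem IsPtwiseFixed.le_or_disjoint_traceKer (h : IsPtwiseFixed τ U) :
    U ≤ traceKer τ.toLinearMap ∨ Disjoint U (traceKer τ.toLinearMap) := by
  obtain ⟨μ, hμ⟩ := isPtwiseFixed_iff_exists_le_eigenspace.1 h
  by_cases hω : μ ∈ omegaRoots K
  · exact .inl (hμ.trans (eigenspace_le_traceKer hω))
  · exact .inr ((disjoint_eigenspace_traceKer hω).mono_left hμ)

theorem finrank_inf_eigenspace_eq_one (hl2 : Module.finrank K l = 2)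
    (hl : l ≤ traceKer τ.toLinearMap) (hfix : IsFixedSubspace τ l) (hne : ¬ IsPtwiseFixed τ l)
    {μ : K} (hμ : μ ∈ omegaRoots K) :
    Module.finrank K (l ⊓ Module.End.eigenspace τ.toLinearMap μ : Submodule K V) = 1 := by
  have : FiniteDimensional K l := Module.finite_of_finrank_pos (by omega)
  have hlt : l ⊓ Module.End.eigenspace τ.toLinearMap μ < l := inf_lt_left.2 fun hle =>
    hne (isPtwiseFixed_iff_exists_le_eigenspace.2 ⟨μ, hle⟩)
  have hbot : l ⊓ Module.End.eigenspace τ.toLinearMap μ ≠ ⊥ := fun h0 => by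
    refine hne (isPtwiseFixed_iff_exists_le_eigenspace.2 ⟨-(1 + μ), fun v hv => ?_⟩)
    have hmem : τ v + (1 + μ) • v ∈ l ⊓ Module.End.eigenspace τ.toLinearMap μ :=
      ⟨l.add_mem (hfix.apply_mem_iff.2 hv) (l.smul_mem _ hv),
        apply_add_smul_mem_eigenspace hμ (hl hv)⟩
    rw [h0, Submodule.mem_bot] at hmem
    rw [Module.End.mem_eigenspace_iff, neg_smul]
    exact eq_neg_of_add_eq_zero_left hmem
  have := Submodule.finrank_lt_finrank_of_lt hlt
  have := Submodule.one_le_finrank_iff.2 hbot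
  omega

variable [Finite K] [Finite V]

theorem ncard_setOf_on_act_eq (hU : U ≤ traceKer τ.toLinearMap) {d : ℕ}
    (hd : ∀ μ ∈ omegaRoots K,
      Module.finrank K (U ⊓ Module.End.eigenspace τ.toLinearMap μ : Submodule K V) = d) :
    {A : ℙ K V | On A U ∧ act τ A = A}.ncard =
      (omegaRoots K).ncard * ∑ i ∈ Finset.range d, Nat.card K ^ i := by
  rw [← ncard_biUnion_eq_mul (Set.toFinite _) (fun _ _ => Set.toFinite _)
    (s := fun μ => {A : ℙ K V | On A (U ⊓ Module.End.eigenspace τ.toLinearMap μ)})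
    fun μ hμ => by rw [ncard_setOf_on, hd μ hμ]]
  · congr 1
    ext A
    induction A using Projectivization.ind with
    | h v hv =>
    simp only [Set.mem_ofPred_eq, Set.mem_iUnion, on_mk, Submodule.mem_inf, exists_prop]
    rw [and_congr_right fun hvU => act_mk_eq_self_iff_exists_mem_eigenspace hU hv hvU]
    tauto
  · refine fun μ _ ν _ hμν => Set.disjoint_left.2 fun A hAμ hAν => ?_
    exact not_disjoint_iff_exists_on.2 ⟨A, le_trans hAμ inf_le_right, le_trans hAν inf_le_right⟩
      (Module.End.disjoint_genEigenspace _ hμν 1 1)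

theorem ncard_setOf_on_line_act_eq (hl2 : Module.finrank K l = 2)
    (hl : l ≤ traceKer τ.toLinearMap) (hfix : IsFixedSubspace τ l)
    (hne : ¬ IsPtwiseFixed τ l) :
    {A : ℙ K V | On A l ∧ act τ A = A}.ncard = (omegaRoots K).ncard := by
  rw [ncard_setOf_on_act_eq hl fun μ hμ => finrank_inf_eigenspace_eq_one hl2 hl hfix hne hμ]
  simp

theorem ncard_omegaRoots_add_ncard_setOf_on_line_act_ne (hl2 : Module.finrank K l = 2)
    (hl : l ≤ traceKer τ.toLinearMap) (hfix : IsFixedSubspace τ l)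
    (hne : ¬ IsPtwiseFixed τ l) :
    (omegaRoots K).ncard + {A : ℙ K V | On A l ∧ act τ A ≠ A}.ncard = Nat.card K + 1 := by
  have hcard := Set.ncard_inter_add_ncard_sdiff_eq_ncard {A : ℙ K V | On A l} {A | act τ A = A}
  rw [ncard_setOf_on, hl2, Finset.sum_range_succ, Finset.sum_range_one, pow_zero, pow_one,
    add_comm 1] at hcard
  rwa [← ncard_setOf_on_line_act_eq hl2 hl hfix hne]

theorem ncard_setOf_exists_le_eigenspace {T : Module.End K V} {S : Set K} {d k : ℕ} (hd : d ≠ 0)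
    (hk : ∀ μ ∈ S,
      {W : Submodule K V | W ≤ T.eigenspace μ ∧ Module.finrank K W = d}.ncard = k) :
    {W : Submodule K V | Module.finrank K W = d ∧ ∃ μ ∈ S, W ≤ T.eigenspace μ}.ncard =
      S.ncard * k := by
  rw [← ncard_biUnion_eq_mul (Set.toFinite _) (fun _ _ => Set.toFinite _) hk]
  · congr 1
    ext W
    simp only [Set.mem_ofPred_eq, Set.mem_iUnion, exists_prop]
    tauto
  · refine fun μ _ ν _ hμν => Set.disjoint_left.2 fun W hWμ hWν => hμν ?_
    refine eigenvalue_unique_of_ne_bot (fun h0 => hd ?_) hWμ.1 hWν.1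
    rw [← hWμ.2, h0, finrank_bot]

end FixedSubspaces

section CubicFrobenius

variable {K L V ι : Type*} [Field K] [Field L] [Algebra K L] [AddCommGroup V] [Module K V]
  [Module L V] [IsScalarTower K L V]

/-- `τ` applies a nontrivial automorphism `f` of a cubic extension to the coordinates with
respect to the basis `b`. This is the normal form, up to scalars, of the linear representative of
the projectivity. -/
structure IsCubicFrobenius (f : L ≃ₐ[K] L) (b : Module.Basis ι L V) (τ : V ≃ₗ[K] V) : Prop where
  finrank_eq_three : Module.finrank K L = 3
  ne_one : f ≠ 1
  map_smul (x : L) (v : V) : τ (x • v) = f x • τ v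
  map_basis (i : ι) : τ (b i) = b i

end CubicFrobenius

namespace IsCubicFrobenius

section Semilinear

variable {K L V ι : Type*} [Field K] [Field L] [Algebra K L] [AddCommGroup V] [Module K V]
  [Module L V] {f : L ≃ₐ[K] L} {b : Module.Basis ι L V} {τ : V ≃ₗ[K] V}

theorem apply_apply_apply (h : IsCubicFrobenius f b τ) (v : V) : τ (τ (τ v)) = v := by
  induction b.mem_span v using Submodule.span_induction with
  | mem v hv =>
    obtain ⟨i, rfl⟩ := hv
    simp only [h.map_basis]
  | zero => simp only [map_zero]
  | add v w _ _ hv hw => rw [map_add, map_add, map_add, hv, hw]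
  | smul x v _ hv =>
    simp only [h.map_smul, hv, algEquiv_apply_apply_apply h.finrank_eq_three]

theorem finiteDimensional (h : IsCubicFrobenius f b τ) : FiniteDimensional K L :=
  Module.finite_of_finrank_pos (h.finrank_eq_three ▸ Nat.succ_pos 2)

theorem exists_smul_fixed (h : IsCubicFrobenius f b τ) {v : V} (hv : v ≠ 0) {y : L}
    (hy : τ v = y • v) : ∃ x : L, x ≠ 0 ∧ τ (x • v) = x • v := by
  have norm_y : y * f y * f (f y) = 1 := by
    refine smul_left_injective L hv ?_
    have := h.apply_apply_apply v
    simp only [hy, h.map_smul, smul_smul, map_mul] at this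
    simp only [one_smul]
    convert this using 2
    ring
  obtain ⟨x, hx, hxy⟩ := exists_apply_mul_eq_self h.finrank_eq_three h.ne_one norm_y
  exact ⟨x, hx, by rw [h.map_smul, hy, smul_smul, hxy]⟩

end Semilinear

variable {K L V ι : Type*} [Field K] [Field L] [Algebra K L] [AddCommGroup V] [Module K V]
  [Module L V] [IsScalarTower K L V] {f : L ≃ₐ[K] L} {b : Module.Basis ι L V} {τ : V ≃ₗ[K] V}

section FixedFamilies

variable {κ : Type*} [Finite κ] {u : κ → V}

theorem finrank_span_inf_eigenspace (h : IsCubicFrobenius f b τ) (hu : LinearIndependent L u)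
    (hτ : ∀ i, τ (u i) = u i) {μ : K} (hμ : μ ^ 3 = 1) :
    Module.finrank K ((Submodule.span L (Set.range u)).restrictScalars K ⊓
      Module.End.eigenspace τ.toLinearMap μ : Submodule K V) = Nat.card κ := by
  have := h.finiteDimensional
  rw [Module.End.eigenspace_def, finrank_span_inf_ker hu (A := f.toLinearMap - μ • 1),
    ← Module.End.eigenspace_def, finrank_eigenspace_algEquiv h.finrank_eq_three h.ne_one hμ,
    mul_one]
  intro x i
  change τ (x • u i) - μ • x • u i = (f x - μ • x) • u i
  rw [h.map_smul, hτ, sub_smul, smul_assoc]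

theorem finrank_span_inf_traceKer (h : IsCubicFrobenius f b τ) (hu : LinearIndependent L u)
    (hτ : ∀ i, τ (u i) = u i) :
    Module.finrank K ((Submodule.span L (Set.range u)).restrictScalars K ⊓
      traceKer τ.toLinearMap : Submodule K V) = Nat.card κ * 2 := by
  have := h.finiteDimensional
  rw [traceKer, finrank_span_inf_ker hu (A := 1 + f.toLinearMap + f.toLinearMap ^ 2),
    ← traceKer, finrank_traceKer_algEquiv h.finrank_eq_three h.ne_one]
  intro x i
  change x • u i + τ (x • u i) + τ (τ (x • u i)) = (x + f x + f (f x)) • u i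
  rw [h.map_smul, hτ, h.map_smul, hτ, add_smul, add_smul]

end FixedFamilies

section TraceKernel

variable [Finite ι]

theorem finrank_eigenspace (h : IsCubicFrobenius f b τ) {μ : K} (hμ : μ ^ 3 = 1) :
    Module.finrank K (Module.End.eigenspace τ.toLinearMap μ) = Nat.card ι := by
  have := h.finrank_span_inf_eigenspace b.linearIndependent h.map_basis hμ
  rwa [b.span_eq, Submodule.restrictScalars_top, top_inf_eq] at this

theorem finrank_traceKer (h : IsCubicFrobenius f b τ) :
    Module.finrank K (traceKer τ.toLinearMap) = Nat.card ι * 2 := by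
  have := h.finrank_span_inf_traceKer b.linearIndependent h.map_basis
  rwa [b.span_eq, Submodule.restrictScalars_top, top_inf_eq] at this

theorem finrank_range_sub_one (h : IsCubicFrobenius f b τ) :
    Module.finrank K (LinearMap.range (τ.toLinearMap - 1)) = Nat.card ι * 2 := by
  have := h.finiteDimensional
  have := Module.Finite.of_basis b
  have : FiniteDimensional K V := Module.Finite.trans L V
  have hV : Module.finrank K V = 3 * Nat.card ι := by
    rw [← Module.finrank_mul_finrank K L V, h.finrank_eq_three,
      Module.finrank_eq_nat_card_basis b]
  have hker := h.finrank_eigenspace (one_pow 3)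
  rw [Module.End.eigenspace_def, one_smul] at hker
  have := (τ.toLinearMap - 1).finrank_range_add_finrank_ker
  omega

theorem eq_traceKer (h : IsCubicFrobenius f b τ) {U : Submodule K V}
    (hU : Module.finrank K U = Nat.card ι * 2) (hτ : ∀ v, τ v - v ∈ U) :
    U = traceKer τ.toLinearMap := by
  have := h.finiteDimensional
  have := Module.Finite.of_basis b
  have : FiniteDimensional K V := Module.Finite.trans L V
  have range_le_U : LinearMap.range (τ.toLinearMap - 1) ≤ U := by
    rintro _ ⟨v, rfl⟩
    exact hτ v
  have range_le_traceKer : LinearMap.range (τ.toLinearMap - 1) ≤ traceKer τ.toLinearMap := by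
    rintro _ ⟨v, rfl⟩
    change τ v - v + τ (τ v - v) + τ (τ (τ v - v)) = 0
    rw [map_sub, map_sub, h.apply_apply_apply]
    abel
  rw [← Submodule.eq_of_le_of_finrank_eq range_le_U (h.finrank_range_sub_one.trans hU.symm),
    Submodule.eq_of_le_of_finrank_eq range_le_traceKer
      (h.finrank_range_sub_one.trans h.finrank_traceKer.symm)]

end TraceKernel

section TypeIPoints

variable {φ : Equiv.Perm (ℙ L V)} {P : ℙ L V}

theorem isTypeI_iff (h : IsCubicFrobenius f b τ)
    (hφ : Function.Semiconj (spreadPoint L) (act τ) φ) :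
    IsTypeI φ P ↔ ∃ (v : V) (hv : v ≠ 0), τ v = v ∧ Projectivization.mk L v hv = P := by
  constructor
  · intro hP
    induction P using Projectivization.ind with
    | h v hv =>
    rw [IsTypeI, ← spreadPoint_mk (K := K), ← hφ, act_mk, spreadPoint_mk, spreadPoint_mk,
      Projectivization.mk_eq_mk_iff'] at hP
    obtain ⟨y, hy⟩ := hP
    obtain ⟨x, hx, hxv⟩ := h.exists_smul_fixed hv hy.symm
    exact ⟨x • v, smul_ne_zero hx hv, hxv, (Projectivization.mk_eq_mk_iff' L _ _ _ _).2 ⟨x, rfl⟩⟩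
  · rintro ⟨v, hv, hτv, rfl⟩
    rw [IsTypeI, ← spreadPoint_mk (K := K), ← hφ, act_mk]
    simp only [hτv]

theorem injOn_spreadPoint (h : IsCubicFrobenius f b τ) :
    Set.InjOn (spreadPoint L)
      {A : ℙ K V | On A (Module.End.eigenspace τ.toLinearMap (1 : K))} := by
  intro A hA B hB hAB
  induction A using Projectivization.ind with
  | h v hv =>
  induction B using Projectivization.ind with
  | h w hw =>
  rw [spreadPoint_mk, spreadPoint_mk, Projectivization.mk_eq_mk_iff'] at hAB
  rw [Set.mem_ofPred_eq, on_mk, Module.End.mem_eigenspace_iff, one_smul] at hA hB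
  obtain ⟨y, rfl⟩ := hAB
  have apply_y : f y = y := by
    refine smul_left_injective L hw ?_
    have hyw : τ (y • w) = y • w := hA
    have hτw : τ w = w := hB
    rwa [h.map_smul, hτw] at hyw
  obtain ⟨a, rfl⟩ :=
    exists_algebraMap_eq_of_apply_eq (h.finrank_eq_three ▸ Nat.prime_three) h.ne_one apply_y
  exact (Projectivization.mk_eq_mk_iff' K _ _ _ _).2 ⟨a, (algebraMap_smul L a w).symm⟩

theorem ncard_isTypeI [Finite ι] [Finite K] (h : IsCubicFrobenius f b τ)
    (hφ : Function.Semiconj (spreadPoint L) (act τ) φ) :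
    {P : ℙ L V | IsTypeI φ P}.ncard = ∑ i ∈ Finset.range (Nat.card ι), Nat.card K ^ i := by
  rw [← h.finrank_eigenspace (one_pow 3), ← ncard_setOf_on, ← h.injOn_spreadPoint.ncard_image]
  congr 1
  ext P
  rw [Set.mem_ofPred_eq, h.isTypeI_iff hφ]
  constructor
  · rintro ⟨v, hv, hτv, rfl⟩
    refine ⟨Projectivization.mk K v hv, on_mk.2 ?_, spreadPoint_mk hv⟩
    exact Module.End.mem_eigenspace_iff.2 (hτv.trans (one_smul K v).symm)
  · rintro ⟨A, hA, rfl⟩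
    induction A using Projectivization.ind with
    | h v hv =>
    have hτv := Module.End.mem_eigenspace_iff.1 (on_mk.1 hA)
    exact ⟨v, hv, hτv.trans (one_smul K v), (spreadPoint_mk hv).symm⟩

theorem finrank_sPlane_inf_traceKer (h : IsCubicFrobenius f b τ)
    (hφ : Function.Semiconj (spreadPoint L) (act τ) φ) (hP : IsTypeI φ P) :
    Module.finrank K (sPlane K P ⊓ traceKer τ.toLinearMap : Submodule K V) = 2 := by
  obtain ⟨v, hv, hτv, rfl⟩ := (h.isTypeI_iff hφ).1 hP
  rw [sPlane_mk_eq, h.finrank_span_inf_traceKer (linearIndependent_unique_iff.2 hv)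
    fun _ => hτv, Nat.card_unique]

theorem not_isPtwiseFixed_sPlane_inf_traceKer (h : IsCubicFrobenius f b τ)
    (hφ : Function.Semiconj (spreadPoint L) (act τ) φ) (hP : IsTypeI φ P) :
    ¬ IsPtwiseFixed τ (sPlane K P ⊓ traceKer τ.toLinearMap) := by
  intro hfix
  obtain ⟨μ, hμ⟩ := isPtwiseFixed_iff_exists_le_eigenspace.1 hfix
  have hrank := h.finrank_sPlane_inf_traceKer hφ hP
  obtain ⟨w, hw, hw0⟩ := Submodule.exists_mem_ne_zero_of_ne_bot
    (p := sPlane K P ⊓ traceKer τ.toLinearMap) fun h0 => by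
      rw [h0, finrank_bot] at hrank
      omega
  have hμ3 := pow_three_eq_one_of_mem_omegaRoots
    ((mem_traceKer_iff_of_mem_eigenspace (hμ hw) hw0).1 hw.2)
  obtain ⟨v, hv, hτv, rfl⟩ := (h.isTypeI_iff hφ).1 hP
  have eigenspace_line : Module.finrank K (sPlane K (Projectivization.mk L v hv) ⊓
      Module.End.eigenspace τ.toLinearMap μ : Submodule K V) = 1 := by
    rw [sPlane_mk_eq, h.finrank_span_inf_eigenspace (linearIndependent_unique_iff.2 hv)
      (fun _ => hτv) hμ3, Nat.card_unique]
  have := Module.finite_of_finrank_pos (eigenspace_line ▸ one_pos)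
  have := Submodule.finrank_mono (le_inf inf_le_left hμ)
  omega

theorem isFixedSubspace_sPlane_inf_traceKer (h : IsCubicFrobenius f b τ)
    (hφ : Function.Semiconj (spreadPoint L) (act τ) φ) (hP : IsTypeI φ P) :
    IsFixedSubspace τ (sPlane K P ⊓ traceKer τ.toLinearMap) := by
  have : FiniteDimensional K (sPlane K P ⊓ traceKer τ.toLinearMap : Submodule K V) :=
    Module.finite_of_finrank_pos (h.finrank_sPlane_inf_traceKer hφ hP ▸ two_pos)
  refine isFixedSubspace_of_forall_apply_mem fun w hw => ⟨?_, apply_mem_traceKer hw.2⟩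
  obtain ⟨v, hv, hτv, rfl⟩ := (h.isTypeI_iff hφ).1 hP
  obtain ⟨x, rfl⟩ := (mem_sPlane_mk hv).1 hw.1
  exact (mem_sPlane_mk hv).2 ⟨f x, ((h.map_smul x v).trans (congrArg _ hτv)).symm⟩

end TypeIPoints

end IsCubicFrobenius

section PtwiseFixedSubspaces

variable {K V : Type*} [Field K] [AddCommGroup V] [Module K V] {τ : V ≃ₗ[K] V}
  {W : Submodule K V}

theorem isPtwiseFixed_and_le_traceKer_iff (hW : W ≠ ⊥) :
    IsPtwiseFixed τ W ∧ W ≤ traceKer τ.toLinearMap ↔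
      ∃ μ ∈ omegaRoots K, W ≤ Module.End.eigenspace τ.toLinearMap μ := by
  rw [isPtwiseFixed_iff_exists_le_eigenspace]
  constructor
  · rintro ⟨⟨μ, hμ⟩, hle⟩
    obtain ⟨v, hv, hv0⟩ := Submodule.exists_mem_ne_zero_of_ne_bot hW
    exact ⟨μ, (mem_traceKer_iff_of_mem_eigenspace (hμ hv) hv0).1 (hle hv), hμ⟩
  · rintro ⟨μ, hω, hμ⟩
    exact ⟨⟨μ, hμ⟩, hμ.trans (eigenspace_le_traceKer hω)⟩

theorem isPtwiseFixed_and_not_le_traceKer_iff (hτ : ∀ v, τ (τ (τ v)) = v) (hW : W ≠ ⊥) :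
    IsPtwiseFixed τ W ∧ ¬ W ≤ traceKer τ.toLinearMap ↔
      ∃ μ ∈ {μ : K | μ ^ 3 = 1} \ omegaRoots K,
        W ≤ Module.End.eigenspace τ.toLinearMap μ := by
  obtain ⟨v, hv, hv0⟩ := Submodule.exists_mem_ne_zero_of_ne_bot hW
  rw [isPtwiseFixed_iff_exists_le_eigenspace]
  constructor
  · rintro ⟨⟨μ, hμ⟩, hle⟩
    refine ⟨μ, ⟨?_, fun hω => hle (hμ.trans (eigenspace_le_traceKer hω))⟩, hμ⟩
    have hτv : τ v = μ • v := Module.End.mem_eigenspace_iff.1 (hμ hv)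
    refine smul_left_injective K hv0 ?_
    have hv3 := hτ v
    simp only [hτv, map_smul, smul_smul] at hv3
    simp only [one_smul]
    convert hv3 using 2
    ring
  · rintro ⟨μ, ⟨-, hω⟩, hμ⟩
    exact ⟨⟨μ, hμ⟩, fun hle =>
      hω ((mem_traceKer_iff_of_mem_eigenspace (hμ hv) hv0).1 (hle hv))⟩

end PtwiseFixedSubspaces

namespace IsCubicFrobenius

variable {K L V ι : Type*} [Field K] [Field L] [Algebra K L] [AddCommGroup V] [Module K V]
  [Module L V] [IsScalarTower K L V] {f : L ≃ₐ[K] L} {b : Module.Basis ι L V} {τ : V ≃ₗ[K] V}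
  {φ : Equiv.Perm (ℙ L V)} [Finite V]

section Points

variable [Finite ι] [Finite K]

theorem ncard_setOf_on_traceKer_act_eq (h : IsCubicFrobenius f b τ) :
    {A : ℙ K V | On A (traceKer τ.toLinearMap) ∧ act τ A = A}.ncard =
      (omegaRoots K).ncard * ∑ i ∈ Finset.range (Nat.card ι), Nat.card K ^ i :=
  ncard_setOf_on_act_eq le_rfl fun μ hμ => by
    rw [inf_eq_right.2 (eigenspace_le_traceKer hμ),
      h.finrank_eigenspace (pow_three_eq_one_of_mem_omegaRoots hμ)]

theorem ncard_setOf_on_traceKer_isIPoint (h : IsCubicFrobenius f b τ)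
    (hφ : Function.Semiconj (spreadPoint L) (act τ) φ) :
    {A : ℙ K V | On A (traceKer τ.toLinearMap) ∧ IsIPoint φ A}.ncard =
      (∑ i ∈ Finset.range (Nat.card ι), Nat.card K ^ i) * (Nat.card K + 1) := by
  rw [← h.ncard_isTypeI hφ, ← ncard_biUnion_eq_mul (Set.toFinite _) (fun _ _ => Set.toFinite _)
    (s := fun P => {A : ℙ K V | On A (sPlane K P ⊓ traceKer τ.toLinearMap)})]
  · congr 1
    ext A
    simp only [Set.mem_iUnion, Set.mem_ofPred_eq, exists_prop, IsIPoint, On, le_inf_iff]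
    tauto
  · intro P hP
    rw [ncard_setOf_on, h.finrank_sPlane_inf_traceKer hφ hP]
    simp [Finset.sum_range_succ, add_comm]
  · intro P _ Q _ hne
    refine Set.disjoint_left.2 fun A hA hA' => hne ?_
    exact (on_sPlane_iff.1 (le_trans hA inf_le_left)).symm.trans
      (on_sPlane_iff.1 (le_trans hA' inf_le_left))

theorem ncard_setOf_on_traceKer_isIColonPoint (h : IsCubicFrobenius f b τ)
    (hφ : Function.Semiconj (spreadPoint L) (act τ) φ) {n : ℤ}
    (hn : ((omegaRoots K).ncard : ℤ) = n + 1) :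
    ({A : ℙ K V | On A (traceKer τ.toLinearMap) ∧ IsIColonPoint φ τ A}.ncard : ℤ) =
      (Nat.card K - n) * ∑ i ∈ Finset.range (Nat.card ι), (Nat.card K : ℤ) ^ i := by
  have hcard := Set.ncard_inter_add_ncard_sdiff_eq_ncard
    {A : ℙ K V | On A (traceKer τ.toLinearMap) ∧ IsIPoint φ A} {A | act τ A = A}
  have fixed_eq : {A : ℙ K V | On A (traceKer τ.toLinearMap) ∧ IsIPoint φ A} ∩ {A | act τ A = A} =
      {A | On A (traceKer τ.toLinearMap) ∧ act τ A = A} := by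
    ext A
    have := isIPoint_of_act_eq hφ (A := A)
    simp only [Set.mem_inter_iff, Set.mem_ofPred_eq]
    tauto
  have moved_eq : {A : ℙ K V | On A (traceKer τ.toLinearMap) ∧ IsIPoint φ A} \ {A | act τ A = A} =
      {A | On A (traceKer τ.toLinearMap) ∧ IsIColonPoint φ τ A} := by
    ext A
    simp only [Set.mem_sdiff, Set.mem_ofPred_eq, and_assoc]
    exact and_congr_right fun hA => (isIColonPoint_iff hA).symm
  rw [fixed_eq, moved_eq, h.ncard_setOf_on_traceKer_act_eq,
    h.ncard_setOf_on_traceKer_isIPoint hφ] at hcard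
  zify at hcard
  rw [hn] at hcard
  linear_combination hcard

theorem ncard_setOf_on_traceKer_isIIColonPoint (h : IsCubicFrobenius f b τ)
    (hφ : Function.Semiconj (spreadPoint L) (act τ) φ) :
    ({A : ℙ K V | On A (traceKer τ.toLinearMap) ∧ IsIIColonPoint φ τ A}.ncard : ℤ) =
      ((Nat.card K : ℤ) ^ Nat.card ι - Nat.card K) *
        ∑ i ∈ Finset.range (Nat.card ι), (Nat.card K : ℤ) ^ i := by
  have hcard := Set.ncard_inter_add_ncard_sdiff_eq_ncard
    {A : ℙ K V | On A (traceKer τ.toLinearMap)} {A | IsIPoint φ A}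
  have moved_eq : {A : ℙ K V | On A (traceKer τ.toLinearMap)} \ {A | IsIPoint φ A} =
      {A | On A (traceKer τ.toLinearMap) ∧ IsIIColonPoint φ τ A} := by
    ext A
    exact and_congr_right fun hA => (isIIColonPoint_iff hφ hA).symm
  rw [moved_eq, ncard_setOf_on, h.finrank_traceKer, mul_two, Finset.sum_range_add,
    Set.inter_def] at hcard
  simp only [Set.mem_ofPred_eq, h.ncard_setOf_on_traceKer_isIPoint hφ, pow_add,
    ← Finset.mul_sum] at hcard
  zify at hcard
  linear_combination hcard

end Points

section FixedSubspaces

variable [Finite K]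

theorem ncard_setOf_isPtwiseFixed_le_traceKer {d k : ℕ} (hd : d ≠ 0)
    (hk : ∀ μ ∈ omegaRoots K, {W : Submodule K V |
      W ≤ Module.End.eigenspace τ.toLinearMap μ ∧ Module.finrank K W = d}.ncard = k) :
    {W : Submodule K V | Module.finrank K W = d ∧ IsPtwiseFixed τ W ∧
      W ≤ traceKer τ.toLinearMap}.ncard = (omegaRoots K).ncard * k := by
  rw [← ncard_setOf_exists_le_eigenspace hd hk]
  congr 1
  ext W
  refine and_congr_right fun hW => isPtwiseFixed_and_le_traceKer_iff ?_
  rintro rfl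
  exact hd (hW.symm.trans (finrank_bot K V))

theorem isFixedILine_and_le_traceKer_iff (h : IsCubicFrobenius f b τ)
    (hφ : Function.Semiconj (spreadPoint L) (act τ) φ) {n : ℤ}
    (hn : ((omegaRoots K).ncard : ℤ) = n + 1) {l : Submodule K V} :
    l ≤ traceKer τ.toLinearMap ∧ IsFixedILine φ τ n l ↔
      ∃ P, IsTypeI φ P ∧ sPlane K P ⊓ traceKer τ.toLinearMap = l := by
  constructor
  · rintro ⟨hl, hl2, -, -, -, P, hP, hlP⟩
    exact ⟨P, hP, (Submodule.eq_of_le_of_finrank_eq (le_inf hlP hl)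
      (hl2.trans (h.finrank_sPlane_inf_traceKer hφ hP).symm)).symm⟩
  · rintro ⟨P, hP, rfl⟩
    have hl2 := h.finrank_sPlane_inf_traceKer hφ hP
    have hfix := h.isFixedSubspace_sPlane_inf_traceKer hφ hP
    have hne := h.not_isPtwiseFixed_sPlane_inf_traceKer hφ hP
    refine ⟨inf_le_right, hl2, hfix, ?_, ?_, P, hP, inf_le_left⟩
    · rw [ncard_setOf_on_line_act_eq hl2 inf_le_right hfix hne, hn]
    · have moved_eq : {A : ℙ K V | On A (sPlane K P ⊓ traceKer τ.toLinearMap) ∧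
            IsIColonPoint φ τ A} =
          {A | On A (sPlane K P ⊓ traceKer τ.toLinearMap) ∧ act τ A ≠ A} := by
        ext A
        refine and_congr_right fun hA => ?_
        rw [isIColonPoint_iff (le_trans hA inf_le_right)]
        exact and_iff_right ⟨P, hP, le_trans hA inf_le_left⟩
      have := ncard_omegaRoots_add_ncard_setOf_on_line_act_ne hl2 inf_le_right hfix hne
      rw [moved_eq]
      omega

theorem ncard_isFixedILine [Finite ι] (h : IsCubicFrobenius f b τ)
    (hφ : Function.Semiconj (spreadPoint L) (act τ) φ) {n : ℤ}
    (hn : ((omegaRoots K).ncard : ℤ) = n + 1) :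
    {l : Submodule K V | l ≤ traceKer τ.toLinearMap ∧ IsFixedILine φ τ n l}.ncard =
      ∑ i ∈ Finset.range (Nat.card ι), Nat.card K ^ i := by
  have image_eq : {l : Submodule K V | l ≤ traceKer τ.toLinearMap ∧ IsFixedILine φ τ n l} =
      (fun P => sPlane K P ⊓ traceKer τ.toLinearMap) '' {P : ℙ L V | IsTypeI φ P} := by
    ext l
    exact h.isFixedILine_and_le_traceKer_iff hφ hn
  rw [image_eq, ← h.ncard_isTypeI hφ]
  refine Set.InjOn.ncard_image fun P hP Q _ heq => ?_
  have hne : sPlane K P ⊓ traceKer τ.toLinearMap ≠ ⊥ := fun h0 => by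
    have := h.finrank_sPlane_inf_traceKer hφ hP
    rw [h0, finrank_bot] at this
    omega
  obtain ⟨v, hv, hv0⟩ := Submodule.exists_mem_ne_zero_of_ne_bot hne
  have spread_P := on_sPlane_iff.1 (on_mk.2 hv.1 : On (Projectivization.mk K v hv0) _)
  have spread_Q := on_sPlane_iff.1 (on_mk.2 (heq.le hv).1 : On (Projectivization.mk K v hv0) _)
  exact spread_P.symm.trans spread_Q

end FixedSubspaces

section Planes

variable {b : Module.Basis (Fin 3) L V}

theorem ncard_setOf_le_eigenspace_finrank_eq_three (h : IsCubicFrobenius f b τ) {μ : K}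
    (hμ : μ ^ 3 = 1) :
    {W : Submodule K V | W ≤ Module.End.eigenspace τ.toLinearMap μ ∧
      Module.finrank K W = 3}.ncard = 1 := by
  have hrank : Module.finrank K (Module.End.eigenspace τ.toLinearMap μ) = 3 :=
    (h.finrank_eigenspace hμ).trans (Nat.card_fin 3)
  refine Set.ncard_eq_one.2 ⟨Module.End.eigenspace τ.toLinearMap μ, ?_⟩
  ext W
  refine ⟨fun ⟨hle, hW⟩ => Submodule.eq_of_le_of_finrank_eq hle (hW.trans hrank.symm), ?_⟩
  rintro rfl
  exact ⟨le_rfl, hrank⟩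

variable [Finite K]

theorem ncard_isPtwiseFixedLine_le_traceKer (h : IsCubicFrobenius f b τ) :
    {l : Submodule K V | l ≤ traceKer τ.toLinearMap ∧ IsPtwiseFixedLine τ l}.ncard =
      (omegaRoots K).ncard * ∑ i ∈ Finset.range 3, Nat.card K ^ i := by
  rw [← ncard_setOf_isPtwiseFixed_le_traceKer (τ := τ) two_ne_zero]
  · congr 1
    ext l
    exact and_comm.trans and_assoc
  · intro μ hμ
    have hμ3 := h.finrank_eigenspace (pow_three_eq_one_of_mem_omegaRoots hμ)
    rw [Nat.card_fin] at hμ3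
    rw [← hμ3, ← ncard_setOf_le_finrank_add_one_eq, hμ3]
    simp only [Nat.reduceEqDiff]

theorem ncard_isPtwiseFixedPlane_le_traceKer (h : IsCubicFrobenius f b τ) :
    {π : Submodule K V | IsPtwiseFixedPlane τ π ∧ π ≤ traceKer τ.toLinearMap}.ncard =
      (omegaRoots K).ncard := by
  rw [← mul_one (omegaRoots K).ncard,
    ← ncard_setOf_isPtwiseFixed_le_traceKer three_ne_zero fun μ hμ =>
      h.ncard_setOf_le_eigenspace_finrank_eq_three (pow_three_eq_one_of_mem_omegaRoots hμ)]
  congr 1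
  ext π
  exact and_assoc

theorem ncard_omegaRoots_add_ncard_isPtwiseFixedPlane_not_le (h : IsCubicFrobenius f b τ) :
    (omegaRoots K).ncard +
      {π : Submodule K V | IsPtwiseFixedPlane τ π ∧ ¬ π ≤ traceKer τ.toLinearMap}.ncard =
        Nat.gcd 3 (Nat.card K - 1) := by
  have card_cubeRoots := Set.ncard_sdiff_add_ncard_of_subset
    (s := omegaRoots K) (t := {μ : K | μ ^ 3 = 1}) fun _ => pow_three_eq_one_of_mem_omegaRoots
  rw [ncard_pow_eq_one three_ne_zero, Nat.gcd_comm] at card_cubeRoots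
  rw [← card_cubeRoots, add_comm,
    ← mul_one (Set.ncard (_ \ _)), ← ncard_setOf_exists_le_eigenspace three_ne_zero fun μ hμ =>
      h.ncard_setOf_le_eigenspace_finrank_eq_three hμ.1]
  congr 2
  ext π
  refine and_assoc.trans (and_congr_right fun hπ =>
    isPtwiseFixed_and_not_le_traceKer_iff h.apply_apply_apply ?_)
  rintro rfl
  exact three_ne_zero (hπ.symm.trans (finrank_bot K V))

end Planes

end IsCubicFrobenius

section InvariantPairs

theorem apply_mem_span_pair {R V : Type*} [Ring R] [AddCommGroup V] [Module R V] {g : R →+* R}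
    (T : V →ₛₗ[g] V) {v : V} (hv : v + T v + T (T v) = 0) {w : V}
    (hw : w ∈ Submodule.span R {v, T v}) : T w ∈ Submodule.span R {v, T v} := by
  have hvl : v ∈ Submodule.span R {v, T v} := Submodule.mem_span_of_mem (by simp)
  have hTvl : T v ∈ Submodule.span R {v, T v} := Submodule.mem_span_of_mem (by simp)
  have span_le_comap : Submodule.span R {v, T v} ≤ (Submodule.span R {v, T v}).comap T := by
    rw [Submodule.span_le, Set.insert_subset_iff, Set.singleton_subset_iff]
    refine ⟨hTvl, ?_⟩
    change T (T v) ∈ Submodule.span R {v, T v}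
    rw [eq_neg_of_add_eq_zero_right hv]
    exact neg_mem (add_mem hvl hTvl)
  exact span_le_comap hw

end InvariantPairs

section LinesThroughIIPoints

variable {K L V : Type*} [Field K] [Field L] [Algebra K L] [AddCommGroup V] [Module K V]
  [Module L V] [IsScalarTower K L V] {τ : V ≃ₗ[K] V} {φ : Equiv.Perm (ℙ L V)}
  {l : Submodule K V} {A B : ℙ K V}

theorem not_isPtwiseFixed_of_not_isIPoint (hφ : Function.Semiconj (spreadPoint L) (act τ) φ)
    (hA : On A l) (hI : ¬ IsIPoint φ A) : ¬ IsPtwiseFixed τ l :=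
  fun hfix => hI (isIPoint_of_act_eq hφ (hfix A hA))

theorem isIPoint_iff_act_eq (hφ : Function.Semiconj (spreadPoint L) (act τ) φ)
    (hl2 : Module.finrank K l = 2) (hfix : IsFixedSubspace τ l) (hA : On A l)
    (hI : ¬ IsIPoint φ A) (hB : On B l) : IsIPoint φ B ↔ act τ B = B := by
  refine ⟨fun hBI => ?_, isIPoint_of_act_eq hφ⟩
  by_contra hne
  rw [isIPoint_iff] at hBI
  have hle : l ≤ sPlane K (spreadPoint L B) :=
    le_of_on_of_on hl2 hne (hfix.on_act hB) hB (on_sPlane_iff.2 ((hφ B).trans hBI))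
      (on_sPlane_iff.2 rfl)
  exact hI ⟨_, hBI, le_trans hA hle⟩

theorem injOn_spreadPoint_of_not_isIPoint (hφ : Function.Semiconj (spreadPoint L) (act τ) φ)
    (hl2 : Module.finrank K l = 2) (hfix : IsFixedSubspace τ l) (hA : On A l)
    (hI : ¬ IsIPoint φ A) : Set.InjOn (spreadPoint L) {B : ℙ K V | On B l} := by
  intro B hB C hC hBC
  by_contra hne
  have hle : l ≤ sPlane K (spreadPoint L B) :=
    le_of_on_of_on hl2 hne hB hC (on_sPlane_iff.2 rfl) (on_sPlane_iff.2 hBC.symm)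
  refine hI (isIPoint_iff.2 ?_)
  rw [IsTypeI, ← hφ, on_sPlane_iff.1 (le_trans hA hle),
    on_sPlane_iff.1 (le_trans (hfix.on_act hA) hle)]

theorem ncard_setOf_not_disjoint_sPlane (hl : Set.InjOn (spreadPoint L) {B : ℙ K V | On B l})
    (p : ℙ L V → Prop) : {P : ℙ L V | p P ∧ ¬ Disjoint l (sPlane K P)}.ncard =
      {B : ℙ K V | On B l ∧ p (spreadPoint L B)}.ncard := by
  rw [← Set.InjOn.ncard_image (hl.mono fun B hB => hB.1)]
  congr 1
  ext P
  simp only [Set.mem_ofPred_eq, Set.mem_image, not_disjoint_sPlane_iff]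
  constructor
  · rintro ⟨hP, B, hB, rfl⟩
    exact ⟨B, ⟨hB, hP⟩, rfl⟩
  · rintro ⟨B, ⟨hB, hP⟩, rfl⟩
    exact ⟨hP, B, hB, rfl⟩

theorem exists_fixed_line_of_act_ne (hA : On A (traceKer τ.toLinearMap)) (hne : act τ A ≠ A) :
    ∃ l : Submodule K V, Module.finrank K l = 2 ∧ l ≤ traceKer τ.toLinearMap ∧
      IsFixedSubspace τ l ∧ On A l := by
  induction A using Projectivization.ind with
  | h v hv =>
  have hl2 := finrank_span_pair_eq_two hv ((mk_ne_mk_iff hv _).1 hne)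
  have : FiniteDimensional K (Submodule.span K {v, τ v}) :=
    Module.finite_of_finrank_pos (hl2 ▸ two_pos)
  refine ⟨Submodule.span K {v, τ v}, hl2, ?_, isFixedSubspace_of_forall_apply_mem fun w hw =>
    apply_mem_span_pair τ.toLinearMap (mem_traceKer.1 (on_mk.1 hA)) hw,
    on_mk.2 (Submodule.mem_span_of_mem (by simp))⟩
  rw [Submodule.span_le, Set.insert_subset_iff, Set.singleton_subset_iff]
  exact ⟨on_mk.1 hA, apply_mem_traceKer (on_mk.1 hA)⟩

end LinesThroughIIPoints

namespace IsCubicFrobenius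

variable {K L V ι : Type*} [Field K] [Field L] [Algebra K L] [AddCommGroup V] [Module K V]
  [Module L V] [IsScalarTower K L V] {f : L ≃ₐ[K] L} {b : Module.Basis ι L V} {τ : V ≃ₗ[K] V}
  {φ : Equiv.Perm (ℙ L V)} {l : Submodule K V} {A : ℙ K V}

theorem isTypeILine_span_pair (h : IsCubicFrobenius f b τ)
    (hφ : Function.Semiconj (spreadPoint L) (act τ) φ) {v : V}
    (hv : v ∈ traceKer τ.toLinearMap)
    (hm2 : Module.finrank L (Submodule.span L {v, τ v}) = 2) :
    IsTypeILine φ (Submodule.span L {v, τ v}) := by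
  let T : V →ₛₗ[(f : L →+* L)] V := { τ.toLinearMap.toAddHom with map_smul' := h.map_smul }
  have apply_mem {w : V} (hw : w ∈ Submodule.span L {v, τ v}) :
      τ w ∈ Submodule.span L {v, τ v} :=
    apply_mem_span_pair T (mem_traceKer.1 hv) hw
  refine ⟨hm2, fun P => ?_⟩
  induction P using Projectivization.ind with
  | h w hw =>
  rw [← spreadPoint_mk (K := K), ← hφ, act_mk, spreadPoint_mk, spreadPoint_mk, on_mk, on_mk]
  exact ⟨apply_mem, fun hτw => h.apply_apply_apply w ▸ apply_mem (apply_mem hτw)⟩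

theorem exists_isTypeILine_le_hSpace (h : IsCubicFrobenius f b τ)
    (hφ : Function.Semiconj (spreadPoint L) (act τ) φ) (hl2 : Module.finrank K l = 2)
    (hl : l ≤ traceKer τ.toLinearMap) (hfix : IsFixedSubspace τ l) (hA : On A l)
    (hI : ¬ IsIPoint φ A) :
    ∃ m : Submodule L V, IsTypeILine φ m ∧ l ≤ hSpace K m ∧
      ∀ m' : Submodule L V, IsSubspaceOfDim 1 m' → l ≤ hSpace K m' → m' = m := by
  have hne : act τ A ≠ A := mt (isIPoint_of_act_eq hφ) hI
  rw [isIPoint_iff, IsTypeI, ← hφ] at hI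
  induction A using Projectivization.ind with
  | h v hv =>
  have hvl : v ∈ l := on_mk.1 hA
  have hτvl : τ v ∈ l := hfix.apply_mem_iff.2 hvl
  simp only [act_mk, spreadPoint_mk] at hI
  have hv' := (mk_ne_mk_iff hv _).1 hI
  refine ⟨Submodule.span L {v, τ v},
    h.isTypeILine_span_pair hφ (hl hvl) (finrank_span_pair_eq_two hv hv'), ?_, fun m' hm' hle =>
    (span_pair_eq_of_finrank_eq_two hm' hv hv' (hle hvl) (hle hτvl)).symm⟩
  rw [← span_pair_eq_of_finrank_eq_two hl2 hv ((mk_ne_mk_iff hv _).1 hne) hvl hτvl]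
  exact Submodule.span_le_restrictScalars K L _

variable [Finite K] [Finite V]

theorem isFixedIILine_of_not_isIPoint (h : IsCubicFrobenius f b τ)
    (hφ : Function.Semiconj (spreadPoint L) (act τ) φ) {n : ℤ}
    (hn : ((omegaRoots K).ncard : ℤ) = n + 1) (hl2 : Module.finrank K l = 2)
    (hl : l ≤ traceKer τ.toLinearMap) (hfix : IsFixedSubspace τ l) (hA : On A l)
    (hI : ¬ IsIPoint φ A) : IsFixedIILine φ τ n l := by
  have hne := not_isPtwiseFixed_of_not_isIPoint hφ hA hI
  have card_fixed := ncard_setOf_on_line_act_eq hl2 hl hfix hne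
  have card_moved := ncard_omegaRoots_add_ncard_setOf_on_line_act_ne hl2 hl hfix hne
  have hinj := injOn_spreadPoint_of_not_isIPoint hφ hl2 hfix hA hI
  have isI_iff {B : ℙ K V} (hB : On B l) := isIPoint_iff_act_eq hφ hl2 hfix hA hI hB
  refine ⟨hl2, hfix, by rw [card_fixed, hn], ?_, ?_, ?_,
    h.exists_isTypeILine_le_hSpace hφ hl2 hl hfix hA hI⟩
  · have eq_moved : {B : ℙ K V | On B l ∧ IsIIColonPoint φ τ B} = {B | On B l ∧ act τ B ≠ B} :=
      Set.ext fun B => and_congr_right fun hB =>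
        (isIIColonPoint_iff hφ (le_trans hB hl)).trans (not_congr (isI_iff hB))
    rw [eq_moved]
    omega
  · have eq_fixed : {B : ℙ K V | On B l ∧ IsTypeI φ (spreadPoint L B)} =
        {B | On B l ∧ act τ B = B} :=
      Set.ext fun B => and_congr_right fun hB => isIPoint_iff.symm.trans (isI_iff hB)
    rw [ncard_setOf_not_disjoint_sPlane hinj, eq_fixed, card_fixed, hn]
  · have eq_moved : {B : ℙ K V | On B l ∧ IsTypeII φ (spreadPoint L B)} =
        {B | On B l ∧ act τ B ≠ B} :=
      Set.ext fun B => and_congr_right fun hB =>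
        isIIPoint_iff.symm.trans ((isIIPoint_iff_not_isIPoint hφ (le_trans hB hl)).trans
          (not_congr (isI_iff hB)))
    rw [ncard_setOf_not_disjoint_sPlane hinj, eq_moved]
    omega

theorem ncard_isIIColonPoint_eq_ncard_isFixedIILine_mul (h : IsCubicFrobenius f b τ)
    (hφ : Function.Semiconj (spreadPoint L) (act τ) φ) {n : ℤ}
    (hn : ((omegaRoots K).ncard : ℤ) = n + 1) :
    ({A : ℙ K V | On A (traceKer τ.toLinearMap) ∧ IsIIColonPoint φ τ A}.ncard : ℤ) =
      {l : Submodule K V | l ≤ traceKer τ.toLinearMap ∧ IsFixedIILine φ τ n l}.ncard *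
        (Nat.card K - n) := by
  obtain ⟨k, hk⟩ := Nat.exists_eq_add_of_le (Set.ncard_le_card (omegaRoots K))
  have hk' : (Nat.card K - n : ℤ) = (k + 1 : ℕ) := by omega
  rw [hk', ← Nat.cast_mul, ← ncard_biUnion_eq_mul (Set.toFinite _) (fun _ _ => Set.toFinite _)
    (s := fun l => {A : ℙ K V | On A l ∧ IsIIColonPoint φ τ A})]
  · congr 2
    ext A
    simp only [Set.mem_iUnion, Set.mem_ofPred_eq, exists_prop]
    constructor
    · rintro ⟨hA, hII⟩
      have hI := (isIIColonPoint_iff hφ hA).1 hII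
      obtain ⟨l, hl2, hl, hfix, hAl⟩ :=
        exists_fixed_line_of_act_ne hA (mt (isIPoint_of_act_eq hφ) hI)
      exact ⟨l, ⟨hl, h.isFixedIILine_of_not_isIPoint hφ hn hl2 hl hfix hAl hI⟩, hAl, hII⟩
    · rintro ⟨l, ⟨hl, -⟩, hA, hII⟩
      exact ⟨le_trans hA hl, hII⟩
  · rintro l ⟨-, -, -, -, card_IIColon, -⟩
    omega
  · rintro l ⟨hl, hl2, hfix, -⟩ l' ⟨-, hl2', hfix', -⟩ hne
    refine Set.disjoint_left.2 fun A ⟨hA, hII⟩ ⟨hA', _⟩ => hne ?_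
    have hAτ := mt (isIPoint_of_act_eq hφ) ((isIIColonPoint_iff hφ (le_trans hA hl)).1 hII)
    exact le_antisymm
      (le_of_on_of_on hl2 hAτ (hfix.on_act hA) hA (hfix'.on_act hA') hA')
      (le_of_on_of_on hl2' hAτ (hfix'.on_act hA') hA' (hfix.on_act hA) hA)

end IsCubicFrobenius

section ProjectiveAction

variable {F W : Type*} [Field F] [AddCommGroup W] [Module F W] {σ τ : W ≃ₗ[F] W}

theorem act_eq_of_forall_eq_smul {c : F} (h : ∀ v, σ v = c • τ v) : act σ = act τ := by
  funext A
  induction A using Projectivization.ind with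
  | h v hv => exact (Projectivization.mk_eq_mk_iff' F _ _ _ _).2 ⟨c, (h v).symm⟩

theorem map_le_map_of_act_eq (h : act σ = act τ) (U : Submodule F W) :
    U.map σ.toLinearMap ≤ U.map τ.toLinearMap := by
  rintro _ ⟨v, hv, rfl⟩
  by_cases hv0 : v = 0
  · simp only [hv0, map_zero, zero_mem]
  obtain ⟨a, ha⟩ := (Projectivization.mk_eq_mk_iff' F _ _ _ _).1
    (congrFun h (Projectivization.mk F v hv0))
  exact ha ▸ Submodule.smul_mem _ a (Submodule.mem_map_of_mem hv)

theorem isFixedSubspace_eq_of_act_eq (h : act σ = act τ) :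
    IsFixedSubspace σ = IsFixedSubspace τ := by
  funext U
  rw [IsFixedSubspace, IsFixedSubspace,
    le_antisymm (map_le_map_of_act_eq h U) (map_le_map_of_act_eq h.symm U)]

theorem isPtwiseFixed_eq_of_act_eq (h : act σ = act τ) : IsPtwiseFixed σ = IsPtwiseFixed τ := by
  funext U
  rw [IsPtwiseFixed, IsPtwiseFixed, h]

theorem isPtwiseFixedLine_eq_of_act_eq (h : act σ = act τ) :
    IsPtwiseFixedLine σ = IsPtwiseFixedLine τ := by
  funext l
  rw [IsPtwiseFixedLine, IsPtwiseFixedLine, isPtwiseFixed_eq_of_act_eq h]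

theorem isPtwiseFixedPlane_eq_of_act_eq (h : act σ = act τ) :
    IsPtwiseFixedPlane σ = IsPtwiseFixedPlane τ := by
  funext π
  rw [IsPtwiseFixedPlane, IsPtwiseFixedPlane, isPtwiseFixed_eq_of_act_eq h]

end ProjectiveAction

section FieldReduction

variable {K L V : Type*} [Field K] [Field L] [Algebra K L] [AddCommGroup V] [Module K V]
  [Module L V] [IsScalarTower K L V] {σ τ : V ≃ₗ[K] V} (φ : Equiv.Perm (ℙ L V))

theorem isIColonPoint_eq_of_act_eq (h : act σ = act τ) :
    IsIColonPoint φ σ = IsIColonPoint φ τ := by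
  funext A
  rw [IsIColonPoint, IsIColonPoint, h]

theorem isIIColonPoint_eq_of_act_eq (h : act σ = act τ) :
    IsIIColonPoint φ σ = IsIIColonPoint φ τ := by
  funext A
  rw [IsIIColonPoint, IsIIColonPoint, h]

theorem isFixedILine_eq_of_act_eq (h : act σ = act τ) : IsFixedILine φ σ = IsFixedILine φ τ := by
  funext n l
  rw [IsFixedILine, IsFixedILine, h, isFixedSubspace_eq_of_act_eq h,
    isIColonPoint_eq_of_act_eq φ h]

theorem isFixedIILine_eq_of_act_eq (h : act σ = act τ) :
    IsFixedIILine φ σ = IsFixedIILine φ τ := by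
  funext n l
  rw [IsFixedIILine, IsFixedIILine, h, isFixedSubspace_eq_of_act_eq h,
    isIIColonPoint_eq_of_act_eq φ h]

end FieldReduction

section Homotheties

variable {F W : Type*} [Field F] [AddCommGroup W] [Module F W]

theorem eq_of_linearIndependent_of_forall_exists_eq_smul {T : W →+ W}
    (hT : ∀ w, ∃ z : F, T w = z • w) {v w : W} (hvw : LinearIndependent F ![v, w]) {y z : F}
    (hv : T v = y • v) (hw : T w = z • w) : y = z := by
  obtain ⟨a, ha⟩ := hT (v + w)
  rw [map_add, hv, hw] at ha
  have hyz := LinearIndependent.pair_iff.1 hvw (y - a) (z - a) (by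
    linear_combination (norm := module) ha)
  exact (sub_eq_zero.1 hyz.1).trans (sub_eq_zero.1 hyz.2).symm

theorem exists_forall_eq_smul_of_forall_exists_eq_smul (hW : 1 < Module.finrank F W) {T : W →+ W}
    (hT : ∀ w, ∃ z : F, T w = z • w) : ∃ y : F, ∀ w, T w = y • w := by
  have := Module.nontrivial_of_finrank_pos (zero_lt_one.trans hW)
  obtain ⟨v, hv⟩ := exists_ne (0 : W)
  obtain ⟨y, hy⟩ := hT v
  have eq_smul_of_linearIndependent {w : W} (hvw : LinearIndependent F ![v, w]) : T w = y • w := by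
    obtain ⟨z, hz⟩ := hT w
    rw [hz, eq_of_linearIndependent_of_forall_exists_eq_smul hT hvw hy hz]
  refine ⟨y, fun w => ?_⟩
  by_cases hvw : LinearIndependent F ![v, w]
  · exact eq_smul_of_linearIndependent hvw
  obtain ⟨u, hvu⟩ := exists_linearIndependent_pair_of_one_lt_finrank hW hv
  rw [LinearIndependent.pair_iff' hv] at hvw hvu
  push Not at hvw
  obtain ⟨a, rfl⟩ := hvw
  have hvu' : LinearIndependent F ![v, a • v + u] :=
    (LinearIndependent.pair_iff' hv).2 fun c hc => hvu (c - a) (by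
      linear_combination (norm := module) hc)
  have key := eq_smul_of_linearIndependent hvu'
  rw [map_add, eq_smul_of_linearIndependent ((LinearIndependent.pair_iff' hv).2 hvu)] at key
  linear_combination (norm := module) key

end Homotheties

section SemilinearRepresentative

variable {K L V : Type*} [Field K] [Field L] [Algebra K L] [AddCommGroup V] [Module K V]
  [Module L V] [IsScalarTower K L V] {σ : V ≃ₗ[K] V} {φ : Equiv.Perm (ℙ L V)}

theorem Induces.exists_apply_smul_eq (hσ : Induces σ φ) (x : L) (v : V) :
    ∃ y : L, σ (x • v) = y • σ v := by
  by_cases hv : v = 0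
  · exact ⟨0, by simp only [hv, smul_zero, map_zero]⟩
  have hmem : x • v ∈ sPlane K (Projectivization.mk L v hv) := (mem_sPlane_mk hv).2 ⟨x, rfl⟩
  have hσmem := Submodule.mem_map_of_mem (f := (σ : V →ₗ[K] V)) hmem
  rw [hσ, hσ.apply_mk] at hσmem
  obtain ⟨y, hy⟩ := (mem_sPlane_mk _).1 hσmem
  exact ⟨y, hy.symm⟩

theorem exists_algHom_of_forall_exists_apply_smul_eq (hV : 1 < Module.finrank L V)
    (hσ : ∀ (x : L) (v : V), ∃ y : L, σ (x • v) = y • σ v) :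
    ∃ f : L →ₐ[K] L, ∀ (x : L) (v : V), σ (x • v) = f x • σ v := by
  have exists_ratio (x : L) : ∃ y : L, ∀ v, σ (x • v) = y • σ v := by
    obtain ⟨y, hy⟩ := exists_forall_eq_smul_of_forall_exists_eq_smul hV
      (T := (σ : V →+ V).comp ((DistribSMul.toAddMonoidHom V x).comp (σ.symm : V →+ V)))
      fun w => by simpa using hσ x (σ.symm w)
    exact ⟨y, fun v => by simpa using hy (σ v)⟩
  choose f hf using exists_ratio
  have := Module.nontrivial_of_finrank_pos (zero_lt_one.trans hV)
  obtain ⟨v, hv⟩ := exists_ne (0 : V)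
  have f_eq {x y : L} (hxy : σ (x • v) = y • σ v) : f x = y :=
    smul_left_injective L (σ.map_ne_zero_iff.2 hv) ((hf x v).symm.trans hxy)
  have map_algebraMap (a : K) : f (algebraMap K L a) = algebraMap K L a :=
    f_eq (by rw [algebraMap_smul, map_smul, algebraMap_smul])
  exact ⟨{
    toFun := f
    map_one' := f_eq (by rw [one_smul, one_smul])
    map_mul' x y := f_eq (by rw [mul_smul, hf, hf, mul_smul])
    map_zero' := f_eq (by rw [zero_smul, map_zero, zero_smul])
    map_add' x y := f_eq (by rw [add_smul, map_add, hf, hf, add_smul])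
    commutes' := map_algebraMap }, hf⟩

theorem exists_algEquiv_of_forall_exists_apply_smul_eq [FiniteDimensional K L]
    (hV : 1 < Module.finrank L V) (hσ : ∀ (x : L) (v : V), ∃ y : L, σ (x • v) = y • σ v) :
    ∃ f : L ≃ₐ[K] L, ∀ (x : L) (v : V), σ (x • v) = f x • σ v := by
  obtain ⟨f, hf⟩ := exists_algHom_of_forall_exists_apply_smul_eq hV hσ
  exact ⟨AlgEquiv.ofBijective f (Algebra.IsAlgebraic.algHom_bijective f), hf⟩

variable {ι : Type*}

theorem Induces.eq_one_of_map_smul (hσ : Induces σ φ)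
    (hsmul : ∀ (x : L) (v : V), σ (x • v) = x • σ v) (b : Module.Basis ι L V) {y : L}
    (hb : ∀ i, σ (b i) = y • b i) : φ = 1 := by
  let T : V →ₗ[L] V := { σ.toLinearMap.toAddHom with map_smul' := hsmul }
  have T_eq : T = y • LinearMap.id := b.ext hb
  ext1 P
  induction P using Projectivization.ind with
  | h v hv =>
  rw [hσ.apply_mk, Equiv.Perm.one_apply, Projectivization.mk_eq_mk_iff']
  exact ⟨y, (LinearMap.congr_fun T_eq v).symm⟩

variable [Fintype ι]

theorem forall_apply_basis_eq_smul_of_apply_sum_eq_smul (b : Module.Basis ι L V) {T : V →+ V}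
    (hb : ∀ i, ∃ z : L, T (b i) = z • b i) {y : L} (hsum : T (∑ i, b i) = y • ∑ i, b i) (i : ι) :
    T (b i) = y • b i := by
  choose d hd using hb
  simp only [map_sum, hd, Finset.smul_sum] at hsum
  have d_eq : d = fun _ => y := b.equivFun.symm.injective (by
    simpa only [b.equivFun_symm_apply] using hsum)
  rw [hd, d_eq]

theorem Induces.exists_forall_apply_basis_eq_smul (hσ : Induces σ φ) (b : Module.Basis ι L V)
    (hb : ∀ (a : ι → K) (h : ∑ i, a i • b i ≠ 0),
      φ (Projectivization.mk L (∑ i, a i • b i) h) = Projectivization.mk L (∑ i, a i • b i) h) :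
    ∃ y : L, ∀ i, σ (b i) = y • b i := by
  classical
  have exists_apply_eq (a : ι → K) : ∃ y : L, σ (∑ i, a i • b i) = y • ∑ i, a i • b i := by
    by_cases h : ∑ i, a i • b i = 0
    · exact ⟨0, by simp only [h, map_zero, smul_zero]⟩
    · have := hb a h
      rw [hσ.apply_mk, Projectivization.mk_eq_mk_iff'] at this
      exact this.imp fun _ => Eq.symm
  obtain ⟨y, hy⟩ := exists_apply_eq 1
  simp only [Pi.one_apply, one_smul] at hy
  refine ⟨y, forall_apply_basis_eq_smul_of_apply_sum_eq_smul b (T := (σ : V →+ V)) (fun i => ?_) hy⟩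
  have := exists_apply_eq (Pi.single i 1)
  simp only [Pi.single_apply, ite_smul, one_smul, zero_smul, Finset.sum_ite_eq', Finset.mem_univ,
    if_true] at this
  exact this

end SemilinearRepresentative

section HyperplanewiseFixed

variable {F W : Type*} [Field F] [AddCommGroup W] [Module F W]
  {σ : W ≃ₗ[F] W} {U : Submodule F W}

theorem exists_comp_eq_smul_of_isFixedSubspace_ker {ℓ : Module.Dual F W}
    (h : IsFixedSubspace σ (LinearMap.ker ℓ)) : ∃ μ : F, ℓ ∘ₗ σ.toLinearMap = μ • ℓ := by
  have ker_le : ⨅ _ : Unit, LinearMap.ker ℓ ≤ LinearMap.ker (ℓ ∘ₗ σ.toLinearMap) := fun v hv =>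
    h.apply_mem_iff.2 (iInf_le (fun _ : Unit => LinearMap.ker ℓ) () hv)
  have := mem_span_of_iInf_ker_le_ker ker_le
  rw [Set.range_const, Submodule.mem_span_singleton] at this
  exact this.imp fun _ => Eq.symm

theorem ne_zero_of_apply_eq_smul {v : W} (hv : v ≠ 0) {c : F} (h : σ v = c • v) : c ≠ 0 := by
  rintro rfl
  exact σ.map_ne_zero_iff.2 hv (h.trans (zero_smul F v))

variable [FiniteDimensional F W]

theorem exists_forall_apply_sub_smul_mem
    (h : ∀ H : Submodule F W, Module.finrank F H + 1 = Module.finrank F W → U ≤ H →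
      IsFixedSubspace σ H) : ∃ c : F, ∀ v, σ v - c • v ∈ U := by
  obtain ⟨c, hc⟩ := exists_eq_smul_of_forall_mem σ.toLinearMap.dualMap U.dualAnnihilator
    fun ℓ hℓ => by
      by_cases h0 : ℓ = 0
      · exact ⟨0, by simp only [h0, map_zero, smul_zero]⟩
      exact exists_comp_eq_smul_of_isFixedSubspace_ker
        (h _ (Module.Dual.finrank_ker_add_one_of_ne_zero h0)
          fun v hv => (Submodule.mem_dualAnnihilator ℓ).1 hℓ v hv)
  refine ⟨c, fun v => (Subspace.forall_mem_dualAnnihilator_apply_eq_zero_iff U _).1 fun ℓ hℓ => ?_⟩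
  rw [map_sub, map_smul, sub_eq_zero]
  exact LinearMap.congr_fun (hc ℓ hℓ) v

theorem exists_ne_zero_apply_eq_smul_of_forall_apply_sub_smul_mem (hU : U ≠ ⊤) {c : F}
    (hc : ∀ v, σ v - c • v ∈ U) : ∃ v, v ≠ 0 ∧ σ v = c • v := by
  have not_surjective :
      ¬ Function.Surjective (σ.toLinearMap - c • (1 : Module.End F W)) := fun hsurj =>
    hU (Submodule.eq_top_iff'.2 fun w => by
      obtain ⟨v, rfl⟩ := hsurj w
      exact hc v)
  rw [← LinearMap.injective_iff_surjective, ← LinearMap.ker_eq_bot] at not_surjective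
  obtain ⟨v, hv, hv0⟩ := Submodule.exists_mem_ne_zero_of_ne_bot not_surjective
  exact ⟨v, hv0, sub_eq_zero.1 hv⟩

end HyperplanewiseFixed

section Normalization

variable {K L V ι : Type*} [Field K] [Field L] [Algebra K L] [AddCommGroup V] [Module K V]
  [Module L V] {σ : V ≃ₗ[K] V}

theorem repr_apply_eq_mul {f : L ≃ₐ[K] L} (hsmul : ∀ (x : L) (v : V), σ (x • v) = f x • σ v)
    (b : Module.Basis ι L V) {d : L} (hd : ∀ i, σ (b i) = d • b i) (v : V) (i : ι) :
    b.repr (σ v) i = d * f (b.repr v i) := by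
  classical
  induction b.mem_span v using Submodule.span_induction with
  | mem v hv =>
    obtain ⟨j, rfl⟩ := hv
    rw [hd, map_smul, Finsupp.smul_apply, smul_eq_mul, b.repr_self, Finsupp.single_apply,
      apply_ite f, map_one, map_zero]
  | zero => simp only [map_zero, Finsupp.zero_apply, mul_zero]
  | add v w _ _ hv hw =>
    simp only [map_add, Finsupp.add_apply, hv, hw, mul_add]
  | smul x v _ hv =>
    rw [hsmul, map_smul, map_smul, Finsupp.smul_apply, Finsupp.smul_apply, hv, smul_eq_mul,
      smul_eq_mul, map_mul, mul_left_comm]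

variable [IsScalarTower K L V]

theorem exists_isCubicFrobenius_of_apply_eq_smul (hL : Module.finrank K L = 3) {f : L ≃ₐ[K] L}
    (hf : f ≠ 1) (hsmul : ∀ (x : L) (v : V), σ (x • v) = f x • σ v) (b : Module.Basis ι L V)
    {d : L} (hd : ∀ i, σ (b i) = d • b i) {v : V} (hv : v ≠ 0) {c : K} (hc : σ v = c • v) :
    ∃ (b' : Module.Basis ι L V) (τ : V ≃ₗ[K] V),
      IsCubicFrobenius f b' τ ∧ ∀ w, σ w = c • τ w := by
  have hc0 := ne_zero_of_apply_eq_smul hv hc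
  obtain ⟨i, hi⟩ : ∃ i, b.repr v i ≠ 0 := by
    by_contra! h0
    exact hv (b.ext_elem fun i => by rw [h0, map_zero, Finsupp.zero_apply])
  have repr_ratio : f (b.repr v i) * d = c • b.repr v i := by
    rw [mul_comm, ← repr_apply_eq_mul hsmul b hd, hc, ← algebraMap_smul L c v, map_smul,
      Finsupp.smul_apply, algebraMap_smul]
  refine ⟨b.isUnitSMul (w := fun _ => b.repr v i) fun _ => hi.isUnit,
    σ.trans (LinearEquiv.smulOfNeZero K V c⁻¹ (inv_ne_zero hc0)), ⟨hL, hf, fun x w => ?_,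
    fun j => ?_⟩, fun w => (smul_inv_smul₀ hc0 _).symm⟩
  · change c⁻¹ • σ (x • w) = f x • c⁻¹ • σ w
    rw [hsmul, smul_comm]
  · change c⁻¹ • σ _ = _
    rw [b.isUnitSMul_apply, hsmul, hd, smul_smul, repr_ratio, smul_assoc, inv_smul_smul₀ hc0]

theorem Induces.exists_isCubicFrobenius {φ : Equiv.Perm (ℙ L V)} (hσ : Induces σ φ)
    (hL : Module.finrank K L = 3) (hφ : φ ≠ 1) {B : Set (ℙ L V)} (hB : IsSubplane K B)
    (hφB : ∀ P ∈ B, φ P = P) {U : Submodule K V} (hU : IsHwiseFixed5Space σ U) :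
    ∃ (f : L ≃ₐ[K] L) (b : Module.Basis (Fin 3) L V) (τ : V ≃ₗ[K] V),
      IsCubicFrobenius f b τ ∧ act σ = act τ ∧ U = traceKer τ.toLinearMap := by
  have : FiniteDimensional K L := Module.finite_of_finrank_pos (by omega)
  obtain ⟨b, rfl⟩ := hB
  have hV : Module.finrank L V = 3 := Module.finrank_eq_card_basis b
  have hV9 : Module.finrank K V = 9 := by rw [← Module.finrank_mul_finrank K L V, hL, hV]
  have : FiniteDimensional K V := Module.finite_of_finrank_pos (by omega)
  have hU6 : Module.finrank K U = 6 := hU.1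
  obtain ⟨f, hf⟩ := exists_algEquiv_of_forall_exists_apply_smul_eq (by omega)
    hσ.exists_apply_smul_eq
  obtain ⟨d, hd⟩ := hσ.exists_forall_apply_basis_eq_smul b fun a h => hφB _ ⟨a, h, rfl⟩
  obtain ⟨c, hc⟩ := exists_forall_apply_sub_smul_mem fun H hH =>
    hU.2 H (Nat.succ_injective (hH.trans hV9))
  have U_ne_top : U ≠ ⊤ := by
    rintro rfl
    rw [finrank_top] at hU6
    omega
  obtain ⟨v, hv, hσv⟩ := exists_ne_zero_apply_eq_smul_of_forall_apply_sub_smul_mem U_ne_top hc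
  have f_ne_one : f ≠ 1 := by
    rintro rfl
    exact hφ (hσ.eq_one_of_map_smul hf b hd)
  obtain ⟨b', τ, h, hστ⟩ := exists_isCubicFrobenius_of_apply_eq_smul hL f_ne_one hf b hd hv hσv
  have hc0 := ne_zero_of_apply_eq_smul hv hσv
  refine ⟨f, b', τ, h, act_eq_of_forall_eq_smul hστ, h.eq_traceKer ?_ fun w => ?_⟩
  · rw [hU6, Nat.card_fin]
  · have := U.smul_mem c⁻¹ (hc w)
    rwa [hστ, smul_sub, inv_smul_smul₀ hc0, inv_smul_smul₀ hc0] at this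

end Normalization

end BoseRep

open BoseRep in
theorem theorem7 {K L V : Type*} [Field K] [Finite K] [Field L] [Algebra K L]
    [AddCommGroup V] [Module K V] [Module L V] [IsScalarTower K L V]
    (q g : ℕ) (n : ℤ)
    (hq : Nat.card K = q) (hq2 : 2 < q)
    (hn : n = -1 ∨ n = 0 ∨ n = 1) (hqn : (q : ℤ) ≡ n [ZMOD 3])
    (hg : g = Nat.gcd 3 (q - 1))
    (hL : Module.finrank K L = 3) (hV : Module.finrank L V = 3)
    (φ : Equiv.Perm (ℙ L V)) (hφ : IsCollineation φ) (hφ3 : orderOf φ = 3)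
    (hφB : ∃ B : Set (ℙ L V), IsSubplane K B ∧ ∀ P ∈ B, φ P = P)
    (σ : V ≃ₗ[K] V) (hσ : Induces σ φ)
    (U : Submodule K V) (hU : IsHwiseFixed5Space σ U) :
    -- points
    (({A : ℙ K V | On A U ∧ act σ A = A}.ncard : ℤ) = (n + 1) * (q ^ 2 + q + 1) ∧
      ({A : ℙ K V | On A U ∧ IsIColonPoint φ σ A}.ncard : ℤ) = (q - n) * (q ^ 2 + q + 1) ∧
      ({A : ℙ K V | On A U ∧ IsIIColonPoint φ σ A}.ncard : ℤ) =
        (q ^ 3 - q) * (q ^ 2 + q + 1)) ∧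
    -- lines
    (({l : Submodule K V | l ≤ U ∧ IsPtwiseFixedLine σ l}.ncard : ℤ) =
        (n + 1) * (q ^ 2 + q + 1) ∧
      {l : Submodule K V | l ≤ U ∧ IsFixedILine φ σ n l}.ncard = q ^ 2 + q + 1 ∧
      ({l : Submodule K V | l ≤ U ∧ IsFixedIILine φ σ n l}.ncard : ℚ) =
        ((q : ℚ) ^ 3 - q) * ((q : ℚ) ^ 2 + q + 1) / (q - n)) ∧
    -- planes
    (({π : Submodule K V | IsPtwiseFixedPlane σ π ∧ π ≤ U}.ncard : ℤ) = n + 1 ∧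
      ({π : Submodule K V | IsPtwiseFixedPlane σ π ∧ ¬ π ≤ U}.ncard : ℤ) = g - (n + 1) ∧
      ∀ π : Submodule K V, IsPtwiseFixedPlane σ π → ¬ π ≤ U → Disjoint π U) := by
  subst hq hg
  obtain ⟨B, hB, hφB⟩ := hφB
  have hφ1 : φ ≠ 1 := fun h1 => by simp only [h1, orderOf_one, OfNat.one_ne_ofNat] at hφ3
  obtain ⟨f, b, τ, h, hact, rfl⟩ := hσ.exists_isCubicFrobenius hL hφ1 hB hφB hU
  have : FiniteDimensional K L := h.finiteDimensional
  have : FiniteDimensional L V := Module.finite_of_finrank_eq_succ hV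
  have : FiniteDimensional K V := Module.Finite.trans L V
  have : Finite V := Module.finite_of_finite K
  have hφτ := hact ▸ hσ.semiconj
  have hΩ : ((omegaRoots K).ncard : ℤ) = n + 1 := ncard_omegaRoots hn hqn
  have hqn0 : (Nat.card K : ℚ) - n ≠ 0 := by exact_mod_cast (by omega : (Nat.card K : ℤ) - n ≠ 0)
  have IIPoints := h.ncard_setOf_on_traceKer_isIIColonPoint hφτ
  have IILines := h.ncard_isIIColonPoint_eq_ncard_isFixedIILine_mul hφτ hΩ
  have planes := h.ncard_omegaRoots_add_ncard_isPtwiseFixedPlane_not_le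
  rw [hact, isIColonPoint_eq_of_act_eq φ hact, isIIColonPoint_eq_of_act_eq φ hact,
    isPtwiseFixedLine_eq_of_act_eq hact, isFixedILine_eq_of_act_eq φ hact,
    isFixedIILine_eq_of_act_eq φ hact, isPtwiseFixedPlane_eq_of_act_eq hact, eq_div_iff hqn0,
    h.ncard_setOf_on_traceKer_act_eq, h.ncard_setOf_on_traceKer_isIColonPoint hφτ hΩ,
    h.ncard_isPtwiseFixedLine_le_traceKer, h.ncard_isFixedILine hφτ hΩ,
    h.ncard_isPtwiseFixedPlane_le_traceKer, Nat.card_fin, geom_sum_three, geom_sum_three,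
    Nat.cast_mul, hΩ]
  rw [Nat.card_fin, geom_sum_three] at IIPoints
  refine ⟨⟨by push_cast; rfl, rfl, IIPoints⟩, ⟨by push_cast; rfl, rfl, ?_⟩, rfl, by omega, ?_⟩
  · exact_mod_cast IILines.symm.trans IIPoints
  · exact fun π hπ hle => hπ.2.le_or_disjoint_traceKer.resolve_left hle
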